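/- **Coherent sites.** Let $\mathcal C$ be a category with pullbacks and finite coproducts. A coherent site structure on $\mathcal C$ consists of a wide subcategory $\mathcal E$ and, for every object $X$, a collection $\mathcal O_X$ of finite families $\{U_i\to X\}_i$ of $\mathcal E$-morphisms ("coverings"), such that: (a) $\mathcal E$ is closed under isomorphisms and base change, and $\emptyset\to X$ is in $\mathcal E$ for every $X$, where $\emptyset$ is the initial object of $\mathcal C$; (b) every $\mathcal E$-morphism $A\to R$ is monic and flat, i.e. $A\times_R(-)$ preserves finite coproducts; (c) for every finite family $\{U_i\to X\}_i$ of $\mathcal E$-morphisms, $\coprod_{i,j}U_i\times_XU_j\rightrightarrows\coprod_iU_i$ has a coequalizer $Q$ in $\mathcal C$, and the morphisms $U_i\to Q$ are in $\mathcal E$; (d) for every covering $\{U_i\to X\}_i$ the fork $\coprod_{i,j}U_i\times_XU_j\rightrightarrows\coprod_iU_i\to X$ is exact (a coequalizer diagram); (e) $\{\mathrm{id}_X\}\in\mathcal O_X$; a finite set of $\mathcal E$-morphisms over $X$ containing a covering is a covering; coverings are stable under base change; and if $S\in\mathcal O_X$ and $T$ is a finite family of $\mathcal E$-morphisms over $X$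 with $V\times_XT\in\mathcal O_V$ for all $(V\to X)\in S$, then $T\in\mathcal O_X$. **The lattice $\Omega_1(R)$.** For $R\in\mathcal C$, preorder the finite families of $\mathcal E$-morphisms over $R$ by $\{U_i\}_i\prec\{V_j\}_j$ iff $\{U_i\times_RV_j\to U_i\}_j\in\mathcal O_{U_i}$ for all $i$. Let $\Omega_1(R)$ be the associated poset. It is a bounded distributive lattice, with joins given by unions and meets by $\{U_i\times_RV_j\}_{i,j}$, and a morphism $A\to R$ induces $\Omega_1(R)\to\Omega_1(A)$, $\{U_i\}\mapsto\{A\times_RU_i\}$. We assume that every $\Omega_1(R)$ is small (relative to the universe in which the underlying spaces below live). **Weak $\mathcal C$-schemes.** A coherent space is a sober, quasi-compact, quasi-separated topological space $X$ with a basis of quasi-compact opens. Let $\Omega_c(X)$ be its lattice of quasi-compact opens. A $\mathcal C^{op}$-valued sheaf on $X$ is a functor $\mathcal O_X:\Omega_c(X)\to\mathcal C$ such that $\coprod_{i,j}\mathcal O_X(W_i\cap W_j)\rightrightarrows\coprod_i\mathcal O_X(W_i)\to\mathcal O_X(\bigcup_iW_i)$ is exact for every finite family $(W_i)$ in $\Omega_c(X)$.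 Let $\tau_X$ be the sheaf $U\mapsto\Omega_c(U)$ of distributive lattices, and let $\sigma_X$ be the sheafification of $U\mapsto\Omega_1(\mathcal O_X(U))$. A weak $\mathcal C$-scheme is a triple $(X,\mathcal O_X,\beta_X)$, where $X$ is a coherent space, $\mathcal O_X$ is a $\mathcal C^{op}$-valued sheaf on $X$, and $\beta_X:\sigma_X\to\tau_X$ is a morphism of sheaves of distributive lattices, such that for $V\subset U$ in $\Omega_c(X)$ and every $\mathcal E$-morphism $A\to\mathcal O_X(U)$ with $V\subset\beta_X(U)(\{A\to\mathcal O_X(U)\})$, the morphism $\mathcal O_X(V)\to\mathcal O_X(U)$ factors through $A$. A morphism $X\to Y$ is a pair $(f,f^\#)$ of a continuous map $f:X\to Y$ under which inverse images of quasi-compact opens are quasi-compact, and a natural family $f^\#_U:\mathcal O_X(f^{-1}U)\to\mathcal O_Y(U)$, such that $\beta_X(f^{-1}U)\circ\Omega_1(f^\#_U)=f^{-1}\circ\beta_Y(U)$ for all $U\in\Omega_c(Y)$. Let $\Gamma(X)=\mathcal O_X(X)$; this is a functor from weak $\mathcal C$-schemes to $\mathcal C$. **Theorem.** The functor $\Gamma$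 from weak $\mathcal C$-schemes to $\mathcal C$ has a right adjoint $\mathrm{Spec}$, which can be described as follows. 1. The underlying space of $\mathrm{Spec}\,R$ is $\mathrm{Spec}^0R=\mathrm{pt}\,\mathrm{comp}\,\Omega_1(R)$, the space of points of the complete lattice of ideals of $\Omega_1(R)$. Every $a\in\Omega_1(R)$ defines the open set of points $p$ with $p({\downarrow}a)=1$, and this identifies $\Omega_1(R)$ with $\Omega_c(\mathrm{Spec}\,R)$. 2. For $U=\{U_i\to R\}_i$, $\mathcal O(U)$ is the coequalizer of $\coprod_{i,j}U_i\times_RU_j\rightrightarrows\coprod_iU_i$. For $U=\{U_i\}\prec V=\{V_j\}$ the morphism $\mathcal O(U)\to\mathcal O(V)$ is the one induced by the projections $U_i\leftarrow U_i\times_RV_j\to V_j$. 3. For $U=\{U_i\to R\}_i$ and an $\mathcal E$-morphism $V\to\mathcal O(U)$, $\beta(U)(\{V\to\mathcal O(U)\})$ is the open set $\{U_i\times_{\mathcal O(U)}V\to U_i\to R\}_i$. 4. For $f:A\to B$ in $\mathcal C$, the morphism $\mathrm{Spec}\,f$ pulls back the open set $\{U_i\to B\}_i$ to $\{A\times_BU_i\to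 A\}_i$, and its sheaf component at this open set is induced by the projections $A\times_BU_i\to U_i$. Moreover the canonical morphism $R\to\Gamma(\mathrm{Spec}\,R)$ is an isomorphism, inverse to the counit $\Gamma(\mathrm{Spec}\,R)\to R$ of the adjunction. Consequently $\mathrm{Spec}$ is fully faithful. -/

import Mathlib

open CategoryTheory CategoryTheory.Limits TopologicalSpace

universe w v u

noncomputable section

/-! ### Finite families of distinguished morphisms -/

/-- A finite family `{Uᵢ ⟶ X}ᵢ` of morphisms with target `X` belonging to the class `E`. -/
structure EFamily {C : Type u} [Category.{v} C] (E : MorphismProperty C) (X : C) where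
  n : ℕ
  obj : Fin n → C
  hom : ∀ i, obj i ⟶ X
  mem : ∀ i, E (hom i)

namespace EFamily

section Basic

variable {C : Type u} [Category.{v} C] {E : MorphismProperty C}

/-- `F ⊆ G` as sets of morphisms with target `X`. -/
def Subset {X : C} (F G : EFamily E X) : Prop :=
  ∀ i, ∃ j, Over.mk (F.hom i) = Over.mk (G.hom j)

/-- The empty family. -/
def empty (E : MorphismProperty C) (X : C) : EFamily E X where
  n := 0
  obj i := i.elim0
  hom i := i.elim0
  mem i := i.elim0

/-- The family consisting of a single morphism. -/
def single {X V : C} (f : V ⟶ X) (hf : E f) : EFamily E X where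
  n := 1
  obj _ := V
  hom _ := f
  mem _ := hf

/-- The family `{X ⟶ X}` consisting of the identity. -/
abbrev unit (E : MorphismProperty C) [E.ContainsIdentities] (X : C) : EFamily E X :=
  single (𝟙 X) (E.id_mem X)

/-- The disjoint union of two families. -/
def union {X : C} (F G : EFamily E X) : EFamily E X where
  n := F.n + G.n
  obj k := Sum.elim F.obj G.obj (finSumFinEquiv.symm k)
  hom k := match finSumFinEquiv.symm k with
    | .inl i => F.hom i
    | .inr j => G.hom j
  mem k := match finSumFinEquiv.symm k with
    | .inl i => F.mem i
    | .inr j => G.mem j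

theorem union_forall {X : C} {F G : EFamily E X} {p : ∀ V : C, (V ⟶ X) → Prop}
    (hF : ∀ i, p (F.obj i) (F.hom i)) (hG : ∀ j, p (G.obj j) (G.hom j)) (k : Fin (F.union G).n) :
    p ((F.union G).obj k) ((F.union G).hom k) := by
  dsimp only [union]
  cases finSumFinEquiv.symm k with
  | inl i => exact hF i
  | inr j => exact hG j

theorem union_exists_left {X : C} {F G : EFamily E X} {p : ∀ V : C, (V ⟶ X) → Prop}
    (i : Fin F.n) (hF : p (F.obj i) (F.hom i)) :
    ∃ k, p ((F.union G).obj k) ((F.union G).hom k) := by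
  refine ⟨finSumFinEquiv (Sum.inl i), ?_⟩
  dsimp only [union]
  generalize hx : finSumFinEquiv.symm (finSumFinEquiv (Sum.inl i)) = x
  obtain rfl : Sum.inl i = x := by simpa using hx
  exact hF

theorem union_exists_right {X : C} {F G : EFamily E X} {p : ∀ V : C, (V ⟶ X) → Prop}
    (j : Fin G.n) (hG : p (G.obj j) (G.hom j)) :
    ∃ k, p ((F.union G).obj k) ((F.union G).hom k) := by
  refine ⟨finSumFinEquiv (Sum.inr j), ?_⟩
  dsimp only [union]
  generalize hx : finSumFinEquiv.symm (finSumFinEquiv (Sum.inr j)) = x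
  obtain rfl : Sum.inr j = x := by simpa using hx
  exact hG

/-- A family `{Pᵢ ⟶ X}ᵢ` obtained from `{Uᵢ ⟶ Y}ᵢ` by base change along `f : X ⟶ Y`, for an
arbitrary choice of the fibre products `Pᵢ = X ×_Y Uᵢ`. -/
abbrev ofIsPullback [E.IsStableUnderBaseChange] {X Y : C} (f : X ⟶ Y) (F : EFamily E Y)
    (P : Fin F.n → C) (p : ∀ i, P i ⟶ X) (q : ∀ i, P i ⟶ F.obj i)
    (h : ∀ i, IsPullback (p i) (q i) f (F.hom i)) : EFamily E X where
  n := F.n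
  obj := P
  hom := p
  mem i := E.of_isPullback (h i).flip (F.mem i)

variable [HasPullbacks C]

/-- The base change `{X ×_Y Uᵢ ⟶ X}ᵢ` of `{Uᵢ ⟶ Y}ᵢ` along `f : X ⟶ Y`. -/
abbrev pullback [E.IsStableUnderBaseChange] {X Y : C} (f : X ⟶ Y) (F : EFamily E Y) :
    EFamily E X :=
  ofIsPullback f F (fun i => Limits.pullback f (F.hom i)) (fun i => pullback.fst f (F.hom i))
    (fun i => pullback.snd f (F.hom i)) (fun i => IsPullback.of_hasPullback f (F.hom i))

/-- The family `{Uᵢ ×_X Vⱼ ⟶ X}ᵢⱼ`. -/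
def inter [E.IsStableUnderBaseChange] [E.IsMultiplicative] {X : C} (F G : EFamily E X) :
    EFamily E X where
  n := F.n * G.n
  obj k := Limits.pullback (F.hom (finProdFinEquiv.symm k).1) (G.hom (finProdFinEquiv.symm k).2)
  hom k := pullback.fst (F.hom (finProdFinEquiv.symm k).1) (G.hom (finProdFinEquiv.symm k).2) ≫
    F.hom (finProdFinEquiv.symm k).1
  mem k := E.comp_mem _ _
    (E.of_isPullback (IsPullback.of_hasPullback _ _).flip (G.mem _)) (F.mem _)

theorem inter_forall [E.IsStableUnderBaseChange] [E.IsMultiplicative] {X : C}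
    {F G : EFamily E X} {p : ∀ V : C, (V ⟶ X) → Prop}
    (h : ∀ i j, p (Limits.pullback (F.hom i) (G.hom j))
      (pullback.fst (F.hom i) (G.hom j) ≫ F.hom i)) (k : Fin (F.inter G).n) :
    p ((F.inter G).obj k) ((F.inter G).hom k) :=
  h _ _

theorem inter_exists [E.IsStableUnderBaseChange] [E.IsMultiplicative] {X : C}
    {F G : EFamily E X} {p : ∀ V : C, (V ⟶ X) → Prop} (i : Fin F.n) (j : Fin G.n)
    (h : p (Limits.pullback (F.hom i) (G.hom j)) (pullback.fst (F.hom i) (G.hom j) ≫ F.hom i)) :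
    ∃ k, p ((F.inter G).obj k) ((F.inter G).hom k) := by
  refine ⟨finProdFinEquiv (i, j), ?_⟩
  have key : ∀ x : Fin F.n × Fin G.n, (i, j) = x → p (Limits.pullback (F.hom x.1) (G.hom x.2))
      (pullback.fst (F.hom x.1) (G.hom x.2) ≫ F.hom x.1) := by
    rintro _ rfl
    exact h
  exact key _ (finProdFinEquiv.symm_apply_apply (i, j)).symm

/-- Given morphisms `gᵢ : Uᵢ ⟶ A` from the members of a family `{Uᵢ ⟶ X}ᵢ` and `f : V ⟶ A` in `E`,
the family of composites `{Uᵢ ×_A V ⟶ Uᵢ ⟶ X}ᵢ`. -/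
def along [E.IsStableUnderBaseChange] [E.IsMultiplicative] {X A V : C} (F : EFamily E X)
    (g : ∀ i, F.obj i ⟶ A) (f : V ⟶ A) (hf : E f) : EFamily E X where
  n := F.n
  obj i := Limits.pullback (g i) f
  hom i := pullback.fst (g i) f ≫ F.hom i
  mem i := E.comp_mem _ _
    (E.of_isPullback (IsPullback.of_hasPullback _ _).flip hf) (F.mem i)

variable [HasFiniteCoproducts C]

/-- The projection `p₁ : ∐ᵢⱼ Uᵢ ×_X Uⱼ ⟶ ∐ᵢ Uᵢ`, given by `Uᵢ ×_X Uⱼ ⟶ Uᵢ`. -/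
def p₁ {X : C} (F : EFamily E X) :
    (∐ fun ij : Fin F.n × Fin F.n => Limits.pullback (F.hom ij.1) (F.hom ij.2)) ⟶ ∐ F.obj :=
  Sigma.desc fun ij => pullback.fst (F.hom ij.1) (F.hom ij.2) ≫ Sigma.ι F.obj ij.1

/-- The projection `p₂ : ∐ᵢⱼ Uᵢ ×_X Uⱼ ⟶ ∐ᵢ Uᵢ`, given by `Uᵢ ×_X Uⱼ ⟶ Uⱼ`. -/
def p₂ {X : C} (F : EFamily E X) :
    (∐ fun ij : Fin F.n × Fin F.n => Limits.pullback (F.hom ij.1) (F.hom ij.2)) ⟶ ∐ F.obj :=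
  Sigma.desc fun ij => pullback.snd (F.hom ij.1) (F.hom ij.2) ≫ Sigma.ι F.obj ij.2

/-- The canonical morphism `∐ᵢ Uᵢ ⟶ X`. -/
def toBase {X : C} (F : EFamily E X) : (∐ F.obj) ⟶ X :=
  Sigma.desc F.hom

theorem p₁_toBase {X : C} (F : EFamily E X) : F.p₁ ≫ F.toBase = F.p₂ ≫ F.toBase := by
  refine Sigma.hom_ext _ _ fun ij => ?_
  simp [p₁, p₂, toBase, pullback.condition]

end Basic

end EFamily

/-! ### Coherent sites -/

/-- A coherent site structure `(E, 𝒪)` on a category `C` with fibre products and finite coproducts: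
a wide subcategory `E` and, for every `X`, a collection `cov X` of finite families of `E`-morphisms
with target `X`. -/
structure CoherentSite (C : Type u) [Category.{v} C] [HasPullbacks C] [HasFiniteCoproducts C] where
  E : MorphismProperty C
  [isMultiplicative : E.IsMultiplicative]
  [respectsIso : E.RespectsIso]
  [isStableUnderBaseChange : E.IsStableUnderBaseChange]
  /-- The initial object of `C` is initial in `E`. -/
  initial_mem : ∀ X : C, E (initial.to X)
  mono : ∀ {A R : C} (f : A ⟶ R), E f → Mono f
  /-- `A ×_R (-)` preserves finite coproducts. -/
  flat : ∀ {A R : C} (f : A ⟶ R), E f → PreservesFiniteCoproducts (Over.pullback f)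
  /-- `∐ Uᵢ ×_X Uⱼ ⇉ ∐ Uᵢ` has a coequalizer, with structure morphisms `Uᵢ ⟶ Q` in `E`. -/
  coequalizer : ∀ {X : C} (F : EFamily E X), ∃ (Q : C) (π : (∐ F.obj) ⟶ Q)
    (hπ : F.p₁ ≫ π = F.p₂ ≫ π), Nonempty (IsColimit (Cofork.ofπ π hπ)) ∧
      ∀ i, E (Sigma.ι F.obj i ≫ π)
  cov : ∀ X : C, Set (EFamily E X)
  /-- Descent: `∐ Uᵢ ×_X Uⱼ ⇉ ∐ Uᵢ ⟶ X` is exact for every covering family. -/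
  descent : ∀ {X : C} (F : EFamily E X), F ∈ cov X →
    Nonempty (IsColimit (Cofork.ofπ F.toBase F.p₁_toBase))
  cov_unit : ∀ X : C, EFamily.unit E X ∈ cov X
  cov_mono : ∀ {X : C} (F G : EFamily E X), F.Subset G → F ∈ cov X → G ∈ cov X
  /-- Stability under base change, for any choice of the fibre products. -/
  cov_pullback : ∀ {X Y : C} (f : X ⟶ Y) (F : EFamily E Y), F ∈ cov Y →
    ∀ (P : Fin F.n → C) (p : ∀ i, P i ⟶ X) (q : ∀ i, P i ⟶ F.obj i)
      (h : ∀ i, IsPullback (p i) (q i) f (F.hom i)), EFamily.ofIsPullback f F P p q h ∈ cov X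
  cov_local : ∀ {X : C} (F G : EFamily E X), F ∈ cov X →
    (∀ i, G.pullback (F.hom i) ∈ cov (F.obj i)) → G ∈ cov X

namespace CoherentSite

attribute [instance] isMultiplicative respectsIso isStableUnderBaseChange

section Omega

variable {C : Type u} [Category.{v} C] [HasPullbacks C] [HasFiniteCoproducts C]
  (S : CoherentSite.{v, u} C)

/-- A family having a member with a section is covering. -/
theorem cov_of_section {X : C} (G : EFamily S.E X) (j : Fin G.n) (s : X ⟶ G.obj j)
    (hs : s ≫ G.hom j = 𝟙 X) : G ∈ S.cov X := by
  have := S.mono _ (G.mem j)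
  have : IsIso (G.hom j) := ⟨⟨s, by rw [← cancel_mono (G.hom j)]; simp [hs], hs⟩⟩
  have hp : IsPullback (G.hom j) (G.hom j) (𝟙 X) (𝟙 X) := IsPullback.of_vert_isIso ⟨rfl⟩
  have h := S.cov_pullback (𝟙 X) (EFamily.unit S.E X) (S.cov_unit X) (fun _ => G.obj j)
    (fun _ => G.hom j) (fun _ => G.hom j) (fun _ => hp)
  exact S.cov_mono _ _ (fun _ => ⟨j, rfl⟩) h

theorem cov_of_factor {V R : C} (h : V ⟶ R) (G : EFamily S.E R) (j : Fin G.n)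
    (s : V ⟶ G.obj j) (hs : s ≫ G.hom j = h) : G.pullback h ∈ S.cov V :=
  S.cov_of_section (G.pullback h) j (pullback.lift (𝟙 V) s (by simp [hs]))
    (pullback.lift_fst _ _ _)

theorem cov_pullback_comp {V W R : C} (a : V ⟶ W) (b : W ⟶ R) (G : EFamily S.E R)
    (hG : G.pullback b ∈ S.cov W) : G.pullback (a ≫ b) ∈ S.cov V :=
  S.cov_pullback a (G.pullback b) hG (fun i => Limits.pullback (a ≫ b) (G.hom i))
    (fun _ => pullback.fst _ _) _
    (fun i => (IsPullback.of_right' (IsPullback.of_hasPullback (a ≫ b) (G.hom i)).flip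
      (IsPullback.of_hasPullback b (G.hom i)).flip).flip)

theorem cov_pullback_pullback {V W R : C} (a : V ⟶ W) (b : W ⟶ R) (G : EFamily S.E R)
    (hG : G.pullback (a ≫ b) ∈ S.cov V) : (G.pullback b).pullback a ∈ S.cov V :=
  S.cov_pullback (𝟙 V) (G.pullback (a ≫ b)) hG _
    (fun i => pullback.fst a (pullback.fst b (G.hom i)))
    (fun i => (pullbackRightPullbackFstIso b (G.hom i) a).hom)
    (fun _ => IsPullback.of_vert_isIso (CommSq.mk (by simp)))

/-- The local character of coverings, for base changes of a family. -/
theorem cov_pullback_local {V R : C} (h : V ⟶ R) (G : EFamily S.E R) (F : EFamily S.E V)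
    (hF : F ∈ S.cov V) (hG : ∀ i, G.pullback (F.hom i ≫ h) ∈ S.cov (F.obj i)) :
    G.pullback h ∈ S.cov V :=
  S.cov_local F _ hF fun i => S.cov_pullback_pullback _ _ _ (hG i)

/-! ### The distributive lattice `Ω₁(R)` -/

/-- The collection `Ω₀(R)` of finite families of `E`-morphisms with target `R`. -/
def Omega0 (R : C) : Type (max u v) :=
  EFamily S.E R

/-- `{Uᵢ} ≺ {Vⱼ}` if and only if `{Uᵢ ×_R Vⱼ ⟶ Uᵢ}ⱼ` is a covering of `Uᵢ` for every `i`. -/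
instance (R : C) : LE (S.Omega0 R) where
  le F G := ∀ i : Fin (EFamily.n F), EFamily.pullback (EFamily.hom F i) G ∈ S.cov _

theorem le_of_factor {R : C} {F G : EFamily S.E R}
    (h : ∀ i, ∃ (j : Fin G.n) (s : F.obj i ⟶ G.obj j), s ≫ G.hom j = F.hom i) :
    LE.le (α := S.Omega0 R) F G := by
  intro i
  obtain ⟨j, s, hs⟩ := h i
  exact S.cov_of_factor _ G j s hs

instance (R : C) : Preorder (S.Omega0 R) where
  le_refl F := S.le_of_factor fun i => ⟨i, 𝟙 _, by simp⟩
  le_trans F G H hFG hGH i := by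
    refine S.cov_pullback_local _ H _ (hFG i) fun j => ?_
    have := S.cov_pullback_comp (pullback.snd (EFamily.hom F i) (EFamily.hom G j)) _ H (hGH j)
    rwa [← pullback.condition] at this

/-- `Ω₁(R)`, the quotient of `Ω₀(R)` by the equivalence relation `a ≺ b ∧ b ≺ a`. -/
def Omega1 (R : C) : Type (max u v) :=
  Antisymmetrization (S.Omega0 R) (· ≤ ·)

instance (R : C) : PartialOrder (S.Omega1 R) :=
  inferInstanceAs (PartialOrder (Antisymmetrization (S.Omega0 R) (· ≤ ·)))

/-- The class in `Ω₁(R)` of a finite family of `E`-morphisms. -/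
def cls {R : C} (F : EFamily S.E R) : S.Omega1 R :=
  toAntisymmetrization (α := S.Omega0 R) (· ≤ ·) F

theorem cls_le_cls {R : C} {F G : EFamily S.E R} :
    S.cls F ≤ S.cls G ↔ ∀ i, G.pullback (F.hom i) ∈ S.cov (F.obj i) :=
  Iff.rfl

theorem cls_le_cls_of_factor {R : C} {F G : EFamily S.E R}
    (h : ∀ i, ∃ (j : Fin G.n) (s : F.obj i ⟶ G.obj j), s ≫ G.hom j = F.hom i) :
    S.cls F ≤ S.cls G :=
  S.le_of_factor h

theorem ind {R : C} {p : S.Omega1 R → Prop} (h : ∀ F, p (S.cls F)) (a : S.Omega1 R) : p a :=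
  Quotient.ind h a

theorem cls_union_le {R : C} {F G H : EFamily S.E R} (hF : S.cls F ≤ S.cls H)
    (hG : S.cls G ≤ S.cls H) : S.cls (F.union G) ≤ S.cls H :=
  EFamily.union_forall (p := fun V f => H.pullback f ∈ S.cov V) hF hG

theorem cls_le_union_left {R : C} (F G : EFamily S.E R) : S.cls F ≤ S.cls (F.union G) :=
  S.cls_le_cls_of_factor fun i =>
    EFamily.union_exists_left (p := fun V f => ∃ s : F.obj i ⟶ V, s ≫ f = F.hom i) i
      ⟨𝟙 _, Category.id_comp _⟩

theorem cls_le_union_right {R : C} (F G : EFamily S.E R) : S.cls G ≤ S.cls (F.union G) :=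
  S.cls_le_cls_of_factor fun i =>
    EFamily.union_exists_right (p := fun V f => ∃ s : G.obj i ⟶ V, s ≫ f = G.hom i) i
      ⟨𝟙 _, Category.id_comp _⟩

theorem cls_inter_le_left {R : C} (F G : EFamily S.E R) : S.cls (F.inter G) ≤ S.cls F :=
  S.cls_le_cls_of_factor <| EFamily.inter_forall
    (p := fun V f => ∃ (j : Fin F.n) (s : V ⟶ F.obj j), s ≫ F.hom j = f)
    fun i _ => ⟨i, pullback.fst _ _, rfl⟩

theorem cls_inter_le_right {R : C} (F G : EFamily S.E R) : S.cls (F.inter G) ≤ S.cls G :=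
  S.cls_le_cls_of_factor <| EFamily.inter_forall
    (p := fun V f => ∃ (j : Fin G.n) (s : V ⟶ G.obj j), s ≫ G.hom j = f)
    fun _ j => ⟨j, pullback.snd _ _, pullback.condition.symm⟩

theorem factor_inter {R V : C} {F G : EFamily S.E R} (h : V ⟶ R) (i : Fin F.n) (j : Fin G.n)
    (s : V ⟶ F.obj i) (hs : s ≫ F.hom i = h) (t : V ⟶ G.obj j) (ht : t ≫ G.hom j = h) :
    ∃ (k : Fin (F.inter G).n) (r : V ⟶ (F.inter G).obj k), r ≫ (F.inter G).hom k = h :=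
  EFamily.inter_exists (p := fun W f => ∃ r : V ⟶ W, r ≫ f = h) i j
    ⟨pullback.lift s t (hs.trans ht.symm), by rw [pullback.lift_fst_assoc, hs]⟩

theorem le_cls_inter {R : C} {F G H : EFamily S.E R} (hF : S.cls H ≤ S.cls F)
    (hG : S.cls H ≤ S.cls G) : S.cls H ≤ S.cls (F.inter G) := by
  rw [cls_le_cls] at *
  intro k
  refine S.cov_pullback_local _ _ _ (hF k) fun i => ?_
  refine S.cov_pullback_local _ _ _
    (S.cov_pullback_comp (pullback.fst (H.hom k) (F.hom i)) _ G (hG k)) fun j => ?_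
  obtain ⟨l, r, hr⟩ := S.factor_inter (F := F) (G := G)
    (pullback.fst (pullback.fst (H.hom k) (F.hom i) ≫ H.hom k) (G.hom j) ≫
      pullback.fst (H.hom k) (F.hom i) ≫ H.hom k) i j
    (pullback.fst _ _ ≫ pullback.snd _ _) (by simp [pullback.condition])
    (pullback.snd _ _) pullback.condition.symm
  exact S.cov_of_factor _ _ l r hr

instance (R : C) : Lattice (S.Omega1 R) where
  sup := Quotient.map₂ EFamily.union fun _ F' hF _ G' hG =>
    ⟨S.cls_union_le (le_trans (b := S.cls F') hF.1 (S.cls_le_union_left _ _))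
      (le_trans (b := S.cls G') hG.1 (S.cls_le_union_right _ _)),
     S.cls_union_le (le_trans (b := S.cls _) hF.2 (S.cls_le_union_left _ _))
      (le_trans (b := S.cls _) hG.2 (S.cls_le_union_right _ _))⟩
  inf := Quotient.map₂ EFamily.inter fun F F' hF G G' hG =>
    ⟨S.le_cls_inter (le_trans (b := S.cls F) (S.cls_inter_le_left _ _) hF.1)
      (le_trans (b := S.cls G) (S.cls_inter_le_right _ _) hG.1),
     S.le_cls_inter (le_trans (b := S.cls F') (S.cls_inter_le_left _ _) hF.2)
      (le_trans (b := S.cls G') (S.cls_inter_le_right _ _) hG.2)⟩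
  le_sup_left := S.ind fun F => S.ind fun G => S.cls_le_union_left F G
  le_sup_right := S.ind fun F => S.ind fun G => S.cls_le_union_right F G
  sup_le := S.ind fun F => S.ind fun G => S.ind fun H => S.cls_union_le (F := F) (G := G) (H := H)
  inf_le_left := S.ind fun F => S.ind fun G => S.cls_inter_le_left F G
  inf_le_right := S.ind fun F => S.ind fun G => S.cls_inter_le_right F G
  le_inf := S.ind fun H => S.ind fun F => S.ind fun G => S.le_cls_inter (F := F) (G := G) (H := H)

theorem cls_sup_cls {R : C} (F G : EFamily S.E R) : S.cls F ⊔ S.cls G = S.cls (F.union G) := rfl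

theorem cls_inf_cls {R : C} (F G : EFamily S.E R) : S.cls F ⊓ S.cls G = S.cls (F.inter G) := rfl

instance (R : C) : DistribLattice (S.Omega1 R) :=
  DistribLattice.ofInfSupLe <| S.ind fun F => S.ind fun G => S.ind fun H => by
    simp only [cls_sup_cls, cls_inf_cls]
    refine S.cls_le_cls_of_factor <| EFamily.inter_forall
      (p := fun V f => ∃ (j : Fin ((F.inter G).union (F.inter H)).n)
        (s : V ⟶ ((F.inter G).union (F.inter H)).obj j),
        s ≫ ((F.inter G).union (F.inter H)).hom j = f) fun i k => ?_
    revert k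
    refine EFamily.union_forall (F := G) (G := H)
      (p := fun W g => ∃ (j : Fin ((F.inter G).union (F.inter H)).n)
        (s : Limits.pullback (F.hom i) g ⟶ ((F.inter G).union (F.inter H)).obj j),
        s ≫ ((F.inter G).union (F.inter H)).hom j = pullback.fst (F.hom i) g ≫ F.hom i) ?_ ?_
    · intro j
      obtain ⟨l, r, hr⟩ := S.factor_inter (F := F) (G := G) _ i j (pullback.fst _ _) rfl
        (pullback.snd _ _) pullback.condition.symm
      exact EFamily.union_exists_left
        (p := fun V f => ∃ s : Limits.pullback (F.hom i) (G.hom j) ⟶ V, s ≫ f = _) l ⟨r, hr⟩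
    · intro j
      obtain ⟨l, r, hr⟩ := S.factor_inter (F := F) (G := H) _ i j (pullback.fst _ _) rfl
        (pullback.snd _ _) pullback.condition.symm
      exact EFamily.union_exists_right
        (p := fun V f => ∃ s : Limits.pullback (F.hom i) (H.hom j) ⟶ V, s ≫ f = _) l ⟨r, hr⟩

instance (R : C) : BoundedOrder (S.Omega1 R) where
  top := S.cls (EFamily.unit S.E R)
  le_top := S.ind fun F => S.cls_le_cls_of_factor fun i =>
    ⟨(0 : Fin 1), F.hom i, Category.comp_id _⟩
  bot := S.cls (EFamily.empty S.E R)
  bot_le := S.ind fun _ => S.cls_le_cls_of_factor fun i => Fin.elim0 i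

theorem top_eq (R : C) : (⊤ : S.Omega1 R) = S.cls (EFamily.unit S.E R) := rfl

theorem bot_eq (R : C) : (⊥ : S.Omega1 R) = S.cls (EFamily.empty S.E R) := rfl

theorem factor_pullback {A R V : C} (f : A ⟶ R) {F : EFamily S.E R} (a : V ⟶ A) (i : Fin F.n)
    (s : V ⟶ F.obj i) (hs : s ≫ F.hom i = a ≫ f) :
    ∃ (k : Fin (F.pullback f).n) (r : V ⟶ (F.pullback f).obj k), r ≫ (F.pullback f).hom k = a :=
  ⟨i, pullback.lift a s hs.symm, pullback.lift_fst _ _ _⟩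

theorem cls_pullback_mono {A R : C} (f : A ⟶ R) {F G : EFamily S.E R} (h : S.cls F ≤ S.cls G) :
    S.cls (F.pullback f) ≤ S.cls (G.pullback f) := by
  rw [cls_le_cls] at *
  intro i
  refine S.cov_pullback_pullback _ _ _ ?_
  have := S.cov_pullback_comp (pullback.snd f (F.hom i)) _ G (h i)
  rwa [← pullback.condition] at this

/-- The homomorphism `Ω₁(R) ⟶ Ω₁(A)`, `{Uᵢ} ↦ {A ×_R Uᵢ}`, induced by `f : A ⟶ R`. -/
def omegaMap {A R : C} (f : A ⟶ R) : BoundedLatticeHom (S.Omega1 R) (S.Omega1 A) where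
  toFun := Quotient.map (EFamily.pullback f) fun _ _ h =>
    ⟨S.cls_pullback_mono f h.1, S.cls_pullback_mono f h.2⟩
  map_sup' := S.ind fun F => S.ind fun G => by
    change S.cls ((F.union G).pullback f) = S.cls ((F.pullback f).union (G.pullback f))
    refine le_antisymm (S.cls_le_cls_of_factor ?_) (S.cls_union_le ?_ ?_)
    · refine EFamily.union_forall (F := F) (G := G)
        (p := fun W g => ∃ (j : Fin ((F.pullback f).union (G.pullback f)).n)
          (s : Limits.pullback f g ⟶ ((F.pullback f).union (G.pullback f)).obj j),
          s ≫ ((F.pullback f).union (G.pullback f)).hom j = pullback.fst f g) ?_ ?_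
      · intro i
        exact EFamily.union_exists_left (F := F.pullback f)
          (p := fun V h => ∃ s : Limits.pullback f (F.hom i) ⟶ V, s ≫ h = _) i
          ⟨𝟙 _, Category.id_comp _⟩
      · intro i
        exact EFamily.union_exists_right (G := G.pullback f)
          (p := fun V h => ∃ s : Limits.pullback f (G.hom i) ⟶ V, s ≫ h = _) i
          ⟨𝟙 _, Category.id_comp _⟩
    · exact S.cls_pullback_mono f (S.cls_le_union_left F G)
    · exact S.cls_pullback_mono f (S.cls_le_union_right F G)
  map_inf' := S.ind fun F => S.ind fun G => by
    change S.cls ((F.inter G).pullback f) = S.cls ((F.pullback f).inter (G.pullback f))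
    refine le_antisymm (S.le_cls_inter ?_ ?_) (S.cls_le_cls_of_factor ?_)
    · exact S.cls_pullback_mono f (S.cls_inter_le_left F G)
    · exact S.cls_pullback_mono f (S.cls_inter_le_right F G)
    · refine EFamily.inter_forall (F := F.pullback f) (G := G.pullback f)
        (p := fun V h => ∃ (k : Fin ((F.inter G).pullback f).n)
          (r : V ⟶ ((F.inter G).pullback f).obj k), r ≫ ((F.inter G).pullback f).hom k = h) ?_
      intro i j
      obtain ⟨k, r, hr⟩ := S.factor_inter (F := F) (G := G)
        ((pullback.fst (pullback.fst f (F.hom i)) (pullback.fst f (G.hom j)) ≫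
          pullback.fst f (F.hom i)) ≫ f) i j
        (pullback.fst _ _ ≫ pullback.snd _ _) (by
          rw [Category.assoc, Category.assoc, pullback.condition (f := f) (g := F.hom i)])
        (pullback.snd _ _ ≫ pullback.snd _ _) (by
          rw [pullback.condition (f := pullback.fst f (F.hom i)), Category.assoc, Category.assoc,
            pullback.condition (f := f) (g := G.hom j)])
      exact S.factor_pullback f _ k r hr
  map_top' := by
    refine top_unique (S.cls_le_cls_of_factor fun _ => ?_)
    exact S.factor_pullback f (𝟙 A) (F := EFamily.unit S.E R) (0 : Fin 1) f
      ((Category.comp_id f).trans (Category.id_comp f).symm)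
  map_bot' := bot_unique (S.cls_le_cls_of_factor fun i => Fin.elim0 i)

theorem omegaMap_cls {A R : C} (f : A ⟶ R) (F : EFamily S.E R) :
    S.omegaMap f (S.cls F) = S.cls (F.pullback f) := rfl

theorem omegaMap_id (R : C) (a : S.Omega1 R) : S.omegaMap (𝟙 R) a = a := by
  induction a using S.ind with
  | h F =>
  refine le_antisymm (S.cls_le_cls_of_factor fun i => ?_) (S.cls_le_cls_of_factor fun i => ?_)
  · exact ⟨i, pullback.snd _ _, by simpa using (pullback.condition (f := 𝟙 R)).symm⟩
  · exact S.factor_pullback _ _ i (𝟙 _) (by simp)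

theorem omegaMap_comp {A B R : C} (f : A ⟶ B) (g : B ⟶ R) (a : S.Omega1 R) :
    S.omegaMap (f ≫ g) a = S.omegaMap f (S.omegaMap g a) := by
  induction a using S.ind with
  | h F =>
  refine le_antisymm (S.cls_le_cls_of_factor fun i => ?_) (S.cls_le_cls_of_factor fun i => ?_)
  · exact S.factor_pullback f (F := F.pullback g) _ i
      (pullback.lift (pullback.fst _ _ ≫ f) (pullback.snd _ _) (by simp [pullback.condition]))
      (pullback.lift_fst _ _ _)
  · refine S.factor_pullback (f ≫ g) (F := F) _ i (pullback.snd _ _ ≫ pullback.snd _ _) ?_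
    rw [Category.assoc, ← pullback.condition, ← Category.assoc, ← pullback.condition,
      Category.assoc]

end Omega

end CoherentSite
/-! ### Coherent spaces

A coherent space is a topological space which is sober (`T0Space` and `QuasiSober`), quasi-compact,
quasi-separated and has a basis of quasi-compact open subsets; this is `SpectralSpace`. The
quasi-compact continuous maps are the `SpectralMap`s, and `Ω_c(X)` is `CompactOpens X`. -/

instance CompactOpens.instDistribLattice (X : Type w) [TopologicalSpace X]
    [QuasiSeparatedSpace X] : DistribLattice (CompactOpens X) where
  __ := (inferInstance : SemilatticeSup (CompactOpens X))
  __ := (inferInstance : SemilatticeInf (CompactOpens X))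
  le_sup_inf U V W := fun x (hx : (x ∈ U ∨ x ∈ V) ∧ (x ∈ U ∨ x ∈ W)) => by
    change x ∈ U ∨ (x ∈ V ∧ x ∈ W)
    tauto

/-- The inverse image of quasi-compact open subsets. -/
def SpectralMap.comap {X Y : Type w} [TopologicalSpace X] [TopologicalSpace Y]
    (f : SpectralMap X Y) (U : CompactOpens Y) : CompactOpens X where
  carrier := f ⁻¹' U
  isCompact' := U.isCompact.preimage_of_isOpen f.spectral' U.isOpen
  isOpen' := U.isOpen.preimage f.spectral'.continuous

theorem SpectralMap.comap_mono {X Y : Type w} [TopologicalSpace X] [TopologicalSpace Y]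
    (f : SpectralMap X Y) {U V : CompactOpens Y} (h : U ≤ V) : f.comap U ≤ f.comap V :=
  fun _ hx => h hx

section Sheaf

variable {C : Type u} [Category.{v} C] [HasFiniteCoproducts C]
  {X : Type w} [TopologicalSpace X] [SpectralSpace X]

/-- `O : Ω_c(X) ⥤ C` is a `Cᵒᵖ`-valued sheaf on the coherent space `X`: for every finite family
`Wᵢ` of quasi-compact open subsets,
`∐ᵢⱼ O(Wᵢ ∩ Wⱼ) ⇉ ∐ᵢ O(Wᵢ) ⟶ O(⋃ᵢ Wᵢ)` is a coequalizer diagram in `C`. -/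
def IsOpSheaf (O : CompactOpens X ⥤ C) : Prop :=
  ∀ (n : ℕ) (W : Fin n → CompactOpens X),
    ∃ h : (Sigma.desc fun ij : Fin n × Fin n =>
          O.map (homOfLE (inf_le_left : W ij.1 ⊓ W ij.2 ≤ W ij.1)) ≫
            Sigma.ι (fun i => O.obj (W i)) ij.1) ≫
        (Sigma.desc fun i => O.map (homOfLE (Finset.le_sup (f := W) (Finset.mem_univ i)))) =
      (Sigma.desc fun ij : Fin n × Fin n =>
          O.map (homOfLE (inf_le_right : W ij.1 ⊓ W ij.2 ≤ W ij.2)) ≫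
            Sigma.ι (fun i => O.obj (W i)) ij.2) ≫
        (Sigma.desc fun i => O.map (homOfLE (Finset.le_sup (f := W) (Finset.mem_univ i)))),
      Nonempty (IsColimit (Cofork.ofπ (P := O.obj (Finset.univ.sup W)) _ h))

end Sheaf

/-- `U ↦ Ω_c(U)` is a sheaf: compatible families of quasi-compact open subsets `Vᵢ ⊆ Wᵢ` glue
uniquely to a quasi-compact open subset of `⋃ᵢ Wᵢ`. -/
theorem CompactOpens.existsUnique_glue {X : Type w} [TopologicalSpace X] [SpectralSpace X] {n : ℕ}
    (W V : Fin n → CompactOpens X) (hVW : ∀ i, V i ≤ W i)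
    (h : ∀ i j, V i ⊓ (W i ⊓ W j) = V j ⊓ (W i ⊓ W j)) :
    ∃! T : CompactOpens X, T ≤ Finset.univ.sup W ∧ ∀ i, T ⊓ W i = V i := by
  refine ⟨Finset.univ.sup V, ⟨Finset.sup_mono_fun fun i _ => hVW i, fun i => ?_⟩, ?_⟩
  · rw [Finset.sup_inf_distrib_right]
    refine le_antisymm (Finset.sup_le fun j _ => ?_) ?_
    · calc V j ⊓ W i = V j ⊓ (W i ⊓ W j) := by
            rw [inf_comm (W i), ← inf_assoc, inf_eq_left.2 (hVW j)]
        _ = V i ⊓ (W i ⊓ W j) := (h i j).symm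
        _ ≤ V i := inf_le_left
    · exact (le_inf le_rfl (hVW i)).trans
        (Finset.le_sup (f := fun j => V j ⊓ W i) (Finset.mem_univ i))
  · rintro T ⟨hT, hTV⟩
    calc T = T ⊓ Finset.univ.sup W := (inf_eq_left.2 hT).symm
      _ = Finset.univ.sup fun i => T ⊓ W i := Finset.sup_inf_distrib_left _ _ _
      _ = Finset.univ.sup V := by simp only [hTV]

/-! ### Weak `C`-schemes -/

section WeakScheme

variable {C : Type u} [Category.{v} C] [HasPullbacks C] [HasFiniteCoproducts C]

/-- A weak `C`-scheme `(X, 𝒪, β)`.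

The distributive lattice `τ(U) = Ω_c(U)` is the lattice `Set.Iic U` of quasi-compact open subsets
of `X` contained in `U`. The support morphism `β : σ ⟶ τ` has as source the sheaf `σ` associated
with the presheaf `U ↦ Ω₁(𝒪(U))` of distributive lattices; since `τ` is a sheaf
(`CompactOpens.existsUnique_glue`), it is, by the universal property of the associated sheaf, a
family of lattice homomorphisms `Ω₁(𝒪(U)) ⟶ τ(U)` compatible with restrictions. -/
structure WeakScheme (S : CoherentSite.{v, u} C) where
  carrier : Type w
  [topologicalSpace : TopologicalSpace carrier]
  [spectralSpace : SpectralSpace carrier]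
  sheaf : CompactOpens carrier ⥤ C
  isOpSheaf : IsOpSheaf sheaf
  support : ∀ U : CompactOpens carrier, BoundedLatticeHom (S.Omega1 (sheaf.obj U)) (Set.Iic U)
  support_map : ∀ {V U : CompactOpens carrier} (h : V ≤ U) (a : S.Omega1 (sheaf.obj U)),
    (support V (S.omegaMap (sheaf.map (homOfLE h)) a) : CompactOpens carrier) =
      (support U a : CompactOpens carrier) ⊓ V
  /-- If `V ⊆ β(U)({A ⟶ 𝒪(U)})`, then `𝒪(V) ⟶ 𝒪(U)` factors through `A ⟶ 𝒪(U)`. -/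
  factor : ∀ {V U : CompactOpens carrier} (h : V ≤ U) {A : C} (j : A ⟶ sheaf.obj U) (hj : S.E j),
    V ≤ (support U (S.cls (EFamily.single j hj)) : CompactOpens carrier) →
      ∃ g : sheaf.obj V ⟶ A, g ≫ j = sheaf.map (homOfLE h)

namespace WeakScheme

attribute [instance] topologicalSpace spectralSpace

/-- A morphism `(f, f^#)` of weak `C`-schemes; `f^#(U) : 𝒪_X(f⁻¹ U) ⟶ 𝒪_Y(U)` in `C`. -/
@[ext]
structure Hom {S : CoherentSite.{v, u} C} (X Y : WeakScheme.{w} S) where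
  base : SpectralMap X.carrier Y.carrier
  app : ∀ U : CompactOpens Y.carrier, X.sheaf.obj (base.comap U) ⟶ Y.sheaf.obj U
  naturality : ∀ {V U : CompactOpens Y.carrier} (h : V ≤ U),
    X.sheaf.map (homOfLE (base.comap_mono h)) ≫ app U = app V ≫ Y.sheaf.map (homOfLE h)
  support_app : ∀ (U : CompactOpens Y.carrier) (a : S.Omega1 (Y.sheaf.obj U)),
    (X.support (base.comap U) (S.omegaMap (app U) a) : CompactOpens X.carrier) =
      base.comap (Y.support U a : CompactOpens Y.carrier)

instance (S : CoherentSite.{v, u} C) : Category (WeakScheme.{w} S) where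
  Hom X Y := Hom X Y
  id X :=
    { base := SpectralMap.id X.carrier
      app := fun U => 𝟙 (X.sheaf.obj U)
      naturality := fun h => (Category.comp_id _).trans (Category.id_comp _).symm
      support_app := fun U a =>
        congrArg (fun b => (X.support U b : CompactOpens X.carrier)) (S.omegaMap_id _ a) }
  comp {X Y Z} f g :=
    { base := g.base.comp f.base
      app := fun U => f.app (g.base.comap U) ≫ g.app U
      naturality := fun {V U} h => by
        have h₁ := f.naturality (g.base.comap_mono h)
        have h₂ := g.naturality h
        calc X.sheaf.map (homOfLE (f.base.comap_mono (g.base.comap_mono h))) ≫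
              f.app (g.base.comap U) ≫ g.app U
            = (f.app (g.base.comap V) ≫ Y.sheaf.map (homOfLE (g.base.comap_mono h))) ≫
                g.app U := by rw [← h₁, Category.assoc]
          _ = (f.app (g.base.comap V) ≫ g.app V) ≫ Z.sheaf.map (homOfLE h) := by
              rw [Category.assoc, h₂, Category.assoc]
      support_app := fun U a => by
        have h₁ := f.support_app (g.base.comap U) (S.omegaMap (g.app U) a)
        rw [g.support_app] at h₁
        exact (congrArg (fun b => (X.support (f.base.comap (g.base.comap U)) b :
          CompactOpens X.carrier)) (S.omegaMap_comp _ _ a)).trans h₁ }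
  id_comp f := Hom.ext rfl (heq_of_eq (funext fun _ => Category.id_comp _))
  comp_id f := Hom.ext rfl (heq_of_eq (funext fun _ => Category.comp_id _))
  assoc f g h := Hom.ext rfl (heq_of_eq (funext fun _ => Category.assoc _ _ _))

/-- The global sections functor `Γ`, `X ↦ 𝒪_X(X)`. -/
def Γ (S : CoherentSite.{v, u} C) : WeakScheme.{w} S ⥤ C where
  obj X := X.sheaf.obj ⊤
  map {X Y} f := X.sheaf.map (homOfLE (show ⊤ ≤ f.base.comap ⊤ from fun _ h => h)) ≫ f.app ⊤
  map_id X := (Category.comp_id _).trans (X.sheaf.map_id _)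
  map_comp {X Y Z} f g := by
    have hf : (⊤ : CompactOpens X.carrier) ≤ f.base.comap ⊤ := fun _ h => h
    have hg : (⊤ : CompactOpens Y.carrier) ≤ g.base.comap ⊤ := fun _ h => h
    have key : X.sheaf.map (homOfLE (hf.trans (f.base.comap_mono hg))) ≫
        f.app (g.base.comap ⊤) ≫ g.app ⊤ =
        (X.sheaf.map (homOfLE hf) ≫ f.app ⊤) ≫ Y.sheaf.map (homOfLE hg) ≫ g.app ⊤ := by
      have h := f.naturality hg
      calc _ = (X.sheaf.map (homOfLE hf) ≫ X.sheaf.map (homOfLE (f.base.comap_mono hg))) ≫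
              f.app (g.base.comap ⊤) ≫ g.app ⊤ := by rw [← Functor.map_comp]; rfl
        _ = X.sheaf.map (homOfLE hf) ≫ (f.app ⊤ ≫ Y.sheaf.map (homOfLE hg)) ≫ g.app ⊤ := by
            rw [← h]
            simp only [Category.assoc]
        _ = _ := by simp only [Category.assoc]
    exact key

end WeakScheme

/-! ### Spectra -/

/-- The space `Spec⁰ R = pt(comp(Ω₁(R)))`: the points of the complete lattice of ideals (non-empty
lower sets closed under finite joins) of the distributive lattice `Ω₁(R)`. -/
abbrev CoherentSite.Spec0 (S : CoherentSite.{v, u} C) (R : C) : Type (max u v) :=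
  Locale.PT (Order.Ideal (S.Omega1 R))

/-- A presentation of a weak `C`-scheme `X` as the spectrum of `R`. -/
structure SpectrumData (S : CoherentSite.{v, u} C) (R : C) (X : WeakScheme.{w} S) where
  /-- `|X| = Spec⁰ R`. -/
  homeo : X.carrier ≃ₜ S.Spec0 R
  /-- The induced identification of `Ω₁(R)` with the lattice of quasi-compact open subsets,
  under which `a` corresponds to the set of points `p` with `p(↓a) = 1`. -/
  basic : S.Omega1 R ≃o CompactOpens X.carrier
  mem_basic : ∀ (a : S.Omega1 R) (x : X.carrier), x ∈ basic a ↔ homeo x (Order.Ideal.principal a)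
  /-- For `U = {Uᵢ ⟶ R}`, a coequalizer `∐ Uᵢ ×_R Uⱼ ⇉ ∐ Uᵢ ⟶ 𝒪(U)`. -/
  π : ∀ F : EFamily S.E R, (∐ F.obj) ⟶ X.sheaf.obj (basic (S.cls F))
  condition : ∀ F : EFamily S.E R, F.p₁ ≫ π F = F.p₂ ≫ π F
  isColimit : ∀ F : EFamily S.E R, IsColimit (Cofork.ofπ (π F) (condition F))
  /-- For `U = {Uᵢ} ≺ {Vⱼ} = V`, the morphism `𝒪(U) ⟶ 𝒪(V)` is the one induced by the projections
  from the `Uᵢ ×_R Vⱼ` to `Uᵢ` and to `Vⱼ`. -/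
  π_map : ∀ (F G : EFamily S.E R) (h : S.cls F ≤ S.cls G) (i : Fin F.n) (j : Fin G.n),
    pullback.fst (F.hom i) (G.hom j) ≫ Sigma.ι F.obj i ≫ π F ≫
        X.sheaf.map (homOfLE (basic.monotone h)) =
      pullback.snd (F.hom i) (G.hom j) ≫ Sigma.ι G.obj j ≫ π G
  /-- The support morphism: for `U = {Uᵢ ⟶ R}` and an `E`-morphism `V ⟶ 𝒪(U)`, the open set
  `β(U)(V)` is `{Uᵢ ×_{𝒪(U)} V ⟶ Uᵢ ⟶ R}`. -/
  support_basic : ∀ (F : EFamily S.E R) {V : C} (f : V ⟶ X.sheaf.obj (basic (S.cls F)))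
    (hf : S.E f),
    (X.support (basic (S.cls F)) (S.cls (EFamily.single f hf)) : CompactOpens X.carrier) =
      basic (S.cls (F.along (fun i => Sigma.ι F.obj i ≫ π F) f hf))

namespace SpectrumData

variable {S : CoherentSite.{v, u} C}

/-- The canonical morphism `R ⟶ Γ(Spec R)`, given by `R ⟶ 𝒪(U)` for `U = {R ⟶ R}`, which is the
whole space. -/
def canonical {R : C} {X : WeakScheme.{w} S} (D : SpectrumData S R X) :
    R ⟶ (WeakScheme.Γ S).obj X :=
  Sigma.ι (EFamily.unit S.E R).obj (0 : Fin 1) ≫ D.π (EFamily.unit S.E R) ≫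
    X.sheaf.map (homOfLE le_top)

/-- The morphism `φ : X ⟶ Y` of spectra is the one induced by `f : A ⟶ B`: it pulls back the open
set `U = {Uᵢ ⟶ B}` to `{A ×_B Uᵢ ⟶ A}`, and `𝒪_X(φ⁻¹ U) ⟶ 𝒪_Y(U)` is induced by the projections
`A ×_B Uᵢ ⟶ Uᵢ`. -/
def IsInducedBy {A B : C} {X Y : WeakScheme.{w} S} (D : SpectrumData S A X)
    (D' : SpectrumData S B Y) (f : A ⟶ B) (φ : X ⟶ Y) : Prop :=
  ∀ F : EFamily S.E B,
    ∃ h : φ.base.comap (D'.basic (S.cls F)) = D.basic (S.cls (F.pullback f)),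
      ∀ i : Fin F.n,
        Sigma.ι (F.pullback f).obj i ≫ D.π (F.pullback f) ≫ X.sheaf.map (homOfLE h.ge) ≫
            φ.app (D'.basic (S.cls F)) =
          pullback.snd f (F.hom i) ≫ Sigma.ι F.obj i ≫ D'.π F

end SpectrumData

end WeakScheme

end

/-!
The points of the frame of ideals of a distributive lattice `L` are the prime ideals of `L`, and
there are enough of them for the quasi-compact open subsets of this space to be exactly the
elements of `L`. So the space of `Spec R` has `Ω₁(R)` as its lattice of quasi-compact opens.

An element `a` of `Ω₁(R)` determines the sieve of the morphisms `T ⟶ R` along which `a` becomes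
`⊤`. The coequalizer `sections a` of a family `{Uᵢ ⟶ R}` representing `a` corepresents the
natural families of morphisms on this sieve: coverings are effective, so such a family is glued
from its values on the `Uᵢ`. This makes `sections a` independent of the representing family and
turns the sheaf property into the statement that the sieve of a join is locally generated by the
sieves of its terms.

A morphism `g : Γ(X) ⟶ R` yields a lattice homomorphism `Ω₁(R) ⟶ Ω_c(X)`, sending `a` to the
support of the pullback of `a` along `g`; hence a map `X ⟶ Spec R`. By the axiom on supports, the
morphism `𝒪(W) ⟶ R` lies in the sieve of `a` for `W` in a finite cover of the inverse image of `a`.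
The resulting morphisms `𝒪(W) ⟶ sections a` glue to the sheaf component at `a`. It is the only
possible one, because `sections {V ⟶ R} ⟶ R` is monic for a single distinguished `V ⟶ R`, and
the basic opens of this kind cover. The counit at `R` is `sections ⊤ ⟶ R`, which has the canonical
morphism as its inverse since the identity of `R` lies in the sieve of `⊤`.
-/

noncomputable section

/-! ### The space of points of a frame of ideals -/

namespace FramePoints

open Locale

variable {M : Type*} [CompleteLattice M]

theorem isOpen_setOf_apply (u : M) : IsOpen {p : PT M | p u} := ⟨u, rfl⟩

instance : T0Space (PT M) where
  t0 _ _ h := FrameHom.ext fun u => propext (h.mem_open_iff (isOpen_setOf_apply u))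

/-- The point given by an irreducible set `Z` of points, for which an open set is true if and only
if it meets `Z`; it is the generic point of `Z` when `Z` is closed. -/
def ofIrreducible {Z : Set (PT M)} (hZ : IsIrreducible Z) : PT M where
  toFun u := (Z ∩ {p | p u}).Nonempty
  map_inf' u v := propext <| by
    simp only [map_inf]
    exact ⟨fun ⟨p, hp, hu, hv⟩ => ⟨⟨p, hp, hu⟩, ⟨p, hp, hv⟩⟩,
      fun h => hZ.2 _ _ (isOpen_setOf_apply u) (isOpen_setOf_apply v) h.1 h.2⟩
  map_top' := eq_true (by simpa using hZ.1)
  map_sSup' s := propext <| by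
    simp only [map_sSup, sSup_image, iSup_Prop_eq, Set.Nonempty, Set.mem_inter_iff,
      Set.mem_ofPred_eq]
    grind

instance : QuasiSober (PT M) where
  sober {Z} hZ hcl := by
    refine ⟨ofIrreducible hZ, Set.ext fun q => ?_⟩
    rw [← specializes_iff_mem_closure, specializes_iff_forall_open]
    nth_rw 2 [← hcl.closure_eq]
    rw [mem_closure_iff]
    simp only [PT.isOpen_iff, forall_exists_index, forall_apply_eq_imp_iff]
    exact forall_congr' fun u => by rw [Set.inter_comm]; rfl

end FramePoints

namespace IdealPoints

open Order Locale

variable {L : Type*}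

section Lattice

variable [Lattice L] [BoundedOrder L]

variable (L) in
/-- The embedding `a ↦ ↓a` of a lattice in its lattice of ideals. -/
def principalHom : BoundedLatticeHom L (Ideal L) where
  toFun := Ideal.principal
  map_sup' a b := eq_of_forall_ge_iff fun I => by
    simp only [Ideal.principal_le_iff, sup_le_iff, Ideal.sup_mem_iff]
  map_inf' a b := by ext x; simp
  map_top' := Ideal.principal_top
  map_bot' := Ideal.principal_bot

theorem sSup_image_principal (I : Ideal L) : sSup (Ideal.principal '' (I : Set L)) = I :=
  eq_of_forall_ge_iff fun J => by
    simp only [sSup_le_iff, Set.forall_mem_image, Ideal.principal_le_iff]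
    rfl

theorem apply_iff (p : PT (Ideal L)) (I : Ideal L) : p I ↔ ∃ a ∈ I, p (Ideal.principal a) := by
  conv_lhs => rw [← sSup_image_principal I, map_sSup, sSup_image]
  simp only [iSup_Prop_eq, exists_prop]
  exact Set.exists_mem_image

variable (L) in
/-- The basic open sets: `basicSet L a` consists of the points `p` with `p(↓a) = 1`. -/
def basicSet : BoundedLatticeHom L (Set (PT (Ideal L))) :=
  (openOfElementHom (Ideal L) : BoundedLatticeHom _ _).comp (principalHom L)

theorem isOpen_basicSet (a : L) : IsOpen (basicSet L a) :=
  FramePoints.isOpen_setOf_apply (Ideal.principal a)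

theorem isTopologicalBasis_range_basicSet : IsTopologicalBasis (Set.range (basicSet L)) := by
  refine isTopologicalBasis_of_isOpen_of_nhds (Set.forall_mem_range.2 isOpen_basicSet) ?_
  rintro p _ hp ⟨I, rfl⟩
  obtain ⟨a, ha, hpa⟩ := (apply_iff p I).1 hp
  exact ⟨_, ⟨a, rfl⟩, hpa, fun q hq => (apply_iff q I).2 ⟨a, ha, hq⟩⟩

theorem eq_of_forall_mem_basicSet_iff {p q : PT (Ideal L)}
    (h : ∀ a, p ∈ basicSet L a ↔ q ∈ basicSet L a) : p = q :=
  FrameHom.ext fun I => propext <| by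
    rw [apply_iff p, apply_iff q]
    exact exists_congr fun a => and_congr_right fun _ => h a

instance [Small.{w} L] : Small.{w} (PT (Ideal L)) :=
  small_of_injective (β := Set L) (f := fun p => {a | p ∈ basicSet L a}) fun _ _ h =>
    eq_of_forall_mem_basicSet_iff (Set.ext_iff.1 h)

end Lattice

section Lift

variable {F : Type*} [Order.Frame F] [Lattice L] [BoundedOrder L]

/-- The ideal of the elements that a homomorphism to a frame maps below `u`. -/
def idealBelow (φ : BoundedLatticeHom L F) (u : F) : Ideal L where
  carrier := {a | φ a ≤ u}
  lower' _ _ hba ha := (OrderHomClass.mono φ hba).trans ha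
  nonempty' := ⟨⊥, (map_bot φ).trans_le bot_le⟩
  directed' a ha b hb := ⟨a ⊔ b, (map_sup φ a b).trans_le (sup_le ha hb), le_sup_left, le_sup_right⟩

theorem gc_biSup_idealBelow (φ : BoundedLatticeHom L F) :
    GaloisConnection (fun I : Ideal L => ⨆ a ∈ I, φ a) (idealBelow φ) :=
  fun _ _ => iSup₂_le_iff

/-- The extension along `a ↦ ↓a` of a homomorphism from a lattice to a frame. -/
def frameLift (φ : BoundedLatticeHom L F) : FrameHom (Ideal L) F where
  toFun I := ⨆ a ∈ I, φ a
  map_inf' I J := by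
    refine le_antisymm (le_inf (biSup_mono fun _ h => h.1) (biSup_mono fun _ h => h.2)) ?_
    simp only [iSup₂_inf_eq, inf_iSup₂_eq, iSup₂_le_iff, ← map_inf]
    exact fun a ha b hb => le_biSup φ (i := b ⊓ a)
      ⟨I.lower inf_le_left hb, J.lower inf_le_right ha⟩
  map_top' := top_unique ((map_top φ).ge.trans (le_biSup φ (i := ⊤) trivial))
  map_sSup' s := (gc_biSup_idealBelow φ).l_sSup.trans (sSup_image ..).symm

theorem frameLift_principal (φ : BoundedLatticeHom L F) (a : L) :
    frameLift φ (Ideal.principal a) = φ a :=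
  le_antisymm (iSup₂_le fun _ h => OrderHomClass.mono φ h)
    (le_biSup φ (i := a) Ideal.mem_principal_self)

end Lift

variable [DistribLattice L] [BoundedOrder L]

/-- The point defined by a prime ideal `J`, for which an ideal is true if and only if it is not
contained in `J`. -/
def ofPrime {J : Ideal L} (hJ : J.IsPrime) : PT (Ideal L) where
  toFun I := ¬ I ≤ J
  map_inf' I I' := propext <| by
    change ¬ I ⊓ I' ≤ J ↔ ¬ I ≤ J ∧ ¬ I' ≤ J
    refine ⟨fun h => ⟨fun hI => h (inf_le_left.trans hI), fun hI => h (inf_le_right.trans hI)⟩, ?_⟩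
    rintro ⟨hI, hI'⟩ h
    obtain ⟨a, ha, haJ⟩ := Set.not_subset.1 hI
    obtain ⟨b, hb, hbJ⟩ := Set.not_subset.1 hI'
    exact (hJ.mem_or_mem (h ⟨I.lower inf_le_left ha, I'.lower inf_le_right hb⟩)).elim haJ hbJ
  map_top' := eq_true fun h => hJ.toIsProper.ne_top (top_unique h)
  map_sSup' s := propext <| by simp [sSup_image]

theorem mem_basicSet_ofPrime {J : Ideal L} (hJ : J.IsPrime) {a : L} :
    ofPrime hJ ∈ basicSet L a ↔ a ∉ J :=
  not_congr Ideal.principal_le_iff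

theorem exists_mem_basicSet_of_notMem {K : Ideal L} {a : L} (ha : a ∉ K) :
    ∃ p ∈ basicSet L a, ∀ b ∈ K, p ∉ basicSet L b := by
  obtain ⟨J, hJ, hKJ, haJ⟩ := DistribLattice.prime_ideal_of_disjoint_filter_ideal
    (F := PFilter.principal a) (I := K)
    (Set.disjoint_left.2 fun b hb hbK => ha (K.lower (PFilter.mem_principal.1 hb) hbK))
  refine ⟨ofPrime hJ, (mem_basicSet_ofPrime hJ).2 ?_, fun b hb => ?_⟩
  · exact Set.disjoint_left.1 haJ (PFilter.mem_principal.2 le_rfl)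
  · exact (mem_basicSet_ofPrime hJ).not_left.2 (hKJ hb)

theorem basicSet_subset_iff {a b : L} : basicSet L a ⊆ basicSet L b ↔ a ≤ b := by
  refine ⟨fun h => ?_, fun h => OrderHomClass.mono (basicSet L) h⟩
  by_contra hab
  obtain ⟨p, hpa, hp⟩ := exists_mem_basicSet_of_notMem (K := Ideal.principal b)
    (mt Ideal.mem_principal.1 hab)
  exact hp b Ideal.mem_principal_self (h hpa)

theorem isCompact_basicSet (a : L) : IsCompact (basicSet L a) := by
  classical
  refine isCompact_of_finite_subcover fun {ι} U hU hcov => ?_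
  let finitelyCovered : Ideal L :=
    { carrier := {x | ∃ t : Finset ι, basicSet L x ⊆ ⋃ i ∈ t, U i}
      lower' := fun x y hyx ⟨t, ht⟩ => ⟨t, (OrderHomClass.mono (basicSet L) hyx).trans ht⟩
      nonempty' := ⟨⊥, ∅, by simp⟩
      directed' := fun x ⟨s, hs⟩ y ⟨t, ht⟩ => ⟨x ⊔ y, ⟨s ∪ t, by
        rw [map_sup, Finset.set_biUnion_union]
        exact Set.union_subset_union hs ht⟩, le_sup_left, le_sup_right⟩ }
  by_contra ha
  obtain ⟨p, hpa, hp⟩ := exists_mem_basicSet_of_notMem (K := finitelyCovered) ha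
  obtain ⟨i, hi⟩ := Set.mem_iUnion.1 (hcov hpa)
  obtain ⟨_, ⟨b, rfl⟩, hpb, hb⟩ :=
    isTopologicalBasis_range_basicSet.exists_subset_of_mem_open hi (hU i)
  exact hp b ⟨{i}, by simpa using hb⟩ hpb

theorem exists_basicSet_eq {s : Set (PT (Ideal L))} (ho : IsOpen s) (hc : IsCompact s) :
    ∃ a, basicSet L a = s := by
  obtain ⟨t, ht, rfl⟩ := (isCompact_open_iff_eq_finite_iUnion_of_isTopologicalBasis
    (basicSet L) isTopologicalBasis_range_basicSet isCompact_basicSet s).1 ⟨hc, ho⟩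
  refine ⟨ht.toFinset.sup id, ?_⟩
  simp [map_finset_sup, Finset.sup_eq_iSup]

instance : SpectralSpace (PT (Ideal L)) where
  isCompact_univ := by
    rw [← Set.top_eq_univ, ← map_top (basicSet L)]
    exact isCompact_basicSet ⊤
  inter_isCompact U V hU hU' hV hV' := by
    obtain ⟨a, rfl⟩ := exists_basicSet_eq hU hU'
    obtain ⟨b, rfl⟩ := exists_basicSet_eq hV hV'
    have hab : basicSet L a ∩ basicSet L b = basicSet L (a ⊓ b) := (map_inf _ a b).symm
    exact hab ▸ isCompact_basicSet (a ⊓ b)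
  toPrespectralSpace :=
    .of_isTopologicalBasis' isTopologicalBasis_range_basicSet isCompact_basicSet

end IdealPoints

/-- The space of points of the frame of ideals of a small distributive lattice, moved to a
given universe. -/
abbrev IdealSpectrum (L : Type*) [DistribLattice L] [BoundedOrder L] [Small.{w} L] : Type w :=
  Shrink.{w} (Locale.PT (Order.Ideal L))

namespace IdealSpectrum

open IdealPoints

variable (L : Type*) [DistribLattice L] [BoundedOrder L] [Small.{w} L]

/-- The identification of the spectrum with the space of points that it is a copy of. -/
def homeo : IdealSpectrum.{w} L ≃ₜ Locale.PT (Order.Ideal L) :=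
  (Shrink.homeomorph _).symm

instance : SpectralSpace (IdealSpectrum.{w} L) :=
  have : CompactSpace (IdealSpectrum.{w} L) := (homeo.{w} L).symm.compactSpace
  (homeo.{w} L).isOpenEmbedding.spectralSpace

/-- The order embedding underlying `IdealSpectrum.basic`. -/
def basicEmbedding : L ↪o CompactOpens (IdealSpectrum.{w} L) :=
  OrderEmbedding.ofMapLEIff
    (fun a =>
      { carrier := homeo.{w} L ⁻¹' basicSet L a
        isCompact' := (homeo.{w} L).isCompact_preimage.2 (isCompact_basicSet a)
        isOpen' := (isOpen_basicSet a).preimage (homeo.{w} L).continuous })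
    fun _ _ => (homeo.{w} L).surjective.preimage_subset_preimage_iff.trans basicSet_subset_iff

theorem basicEmbedding_surjective : Function.Surjective (basicEmbedding.{w} L) := by
  intro U
  obtain ⟨a, ha⟩ := exists_basicSet_eq (s := (homeo.{w} L).symm ⁻¹' U)
    (U.isOpen.preimage (homeo.{w} L).symm.continuous)
    ((homeo.{w} L).symm.isCompact_preimage.2 U.isCompact)
  refine ⟨a, CompactOpens.ext ?_⟩
  change homeo.{w} L ⁻¹' basicSet L a = U
  rw [ha, ← Set.preimage_comp, Homeomorph.symm_comp_self, Set.preimage_id]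

/-- The identification of a distributive lattice with the lattice of quasi-compact open subsets of
its spectrum, by `a ↦ {p | p(↓a) = 1}`. -/
def basic : L ≃o CompactOpens (IdealSpectrum.{w} L) :=
  RelIso.ofSurjective (basicEmbedding L) (basicEmbedding_surjective L)

theorem mem_basic {L : Type*} [DistribLattice L] [BoundedOrder L] [Small.{w} L] (a : L)
    (x : IdealSpectrum.{w} L) : x ∈ basic L a ↔ homeo L x (Order.Ideal.principal a) := Iff.rfl

end IdealSpectrum

/-! ### Spectral maps -/

section SpectralMaps

variable {X Y : Type w} [TopologicalSpace X] [TopologicalSpace Y]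

theorem spectralMap_ext_of_comap_eq [PrespectralSpace Y] [T0Space Y] {f g : SpectralMap X Y}
    (h : ∀ U, f.comap U = g.comap U) : f = g :=
  SpectralMap.ext fun x => (PrespectralSpace.isTopologicalBasis (X := Y)).eq_iff.2 fun s hs =>
    SetLike.ext_iff.1 (h ⟨⟨s, hs.2⟩, hs.1⟩) x

variable (X) in
/-- The inclusion of the lattice of quasi-compact open subsets in the frame of open subsets. -/
def compactOpensInclusion [CompactSpace X] [QuasiSeparatedSpace X] :
    BoundedLatticeHom (CompactOpens X) (Opens X) where
  toFun := CompactOpens.toOpens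
  map_sup' _ _ := rfl
  map_inf' _ _ := rfl
  map_top' := rfl
  map_bot' := rfl

namespace IdealSpectrum

variable {L : Type*} [DistribLattice L] [BoundedOrder L] [Small.{w} L]
  [CompactSpace X] [QuasiSeparatedSpace X] (ψ : BoundedLatticeHom L (CompactOpens X))

/-- The map to the spectrum of `L` for which the inverse image of the basic open set of `a` is
`ψ a`. -/
def mapTo (x : X) : IdealSpectrum.{w} L :=
  (homeo L).symm <| (Locale.localePointOfSpacePoint X x).comp <|
    IdealPoints.frameLift ((compactOpensInclusion X).comp ψ)

theorem homeo_mapTo_apply (x : X) (I : Order.Ideal L) :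
    homeo L (mapTo ψ x) I ↔ x ∈ IdealPoints.frameLift ((compactOpensInclusion X).comp ψ) I := by
  rw [mapTo, Homeomorph.apply_symm_apply]
  rfl

theorem preimage_mapTo_basic (a : L) : mapTo ψ ⁻¹' (basic L a) = (ψ a : Set X) := by
  ext x
  change mapTo ψ x ∈ basic L a ↔ x ∈ (ψ a).toOpens
  rw [mem_basic, homeo_mapTo_apply, IdealPoints.frameLift_principal]
  rfl

theorem isSpectralMap_mapTo : IsSpectralMap (mapTo ψ) where
  isOpen_preimage := by
    have h : Continuous fun x => homeo L (mapTo ψ x) := continuous_def.2 <| by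
      rintro _ ⟨I, rfl⟩
      convert (IdealPoints.frameLift ((compactOpensInclusion X).comp ψ) I).isOpen
      exact Set.ext fun x => homeo_mapTo_apply ψ x I
    exact ((homeo L).comp_continuous_iff.1 h).isOpen_preimage
  isCompact_preimage_of_isOpen s ho hc := by
    obtain ⟨a, ha⟩ := (basic L).surjective ⟨⟨s, hc⟩, ho⟩
    have hs : s = basic L a := by rw [ha]; rfl
    rw [hs, preimage_mapTo_basic]
    exact (ψ a).isCompact

/-- `IdealSpectrum.mapTo` as a spectral map. -/
def spectralMapTo : SpectralMap X (IdealSpectrum.{w} L) :=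
  ⟨mapTo ψ, isSpectralMap_mapTo ψ⟩

theorem comap_spectralMapTo_basic (a : L) : (spectralMapTo ψ).comap (basic L a) = ψ a :=
  CompactOpens.ext (preimage_mapTo_basic ψ a)

end IdealSpectrum

end SpectralMaps

namespace EFamily

variable {C : Type u} [Category.{v} C] {E : MorphismProperty C} {X : C} (F : EFamily E X)

theorem ι_toBase [HasFiniteCoproducts C] (i : Fin F.n) : Sigma.ι F.obj i ≫ F.toBase = F.hom i :=
  Sigma.ι_desc _ _

variable [HasPullbacks C]

/-- A family of morphisms `zᵢ : Uᵢ ⟶ Z` on the members of `{Uᵢ ⟶ X}ᵢ` is compatible if the two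
restrictions to each `Uᵢ ×_X Uⱼ` agree. -/
def IsCompatible {Z : C} (z : ∀ i, F.obj i ⟶ Z) : Prop :=
  ∀ i j, pullback.fst (F.hom i) (F.hom j) ≫ z i = pullback.snd (F.hom i) (F.hom j) ≫ z j

namespace IsCompatible

variable {F} {Z : C} {z : ∀ i, F.obj i ⟶ Z}

theorem comp_eq_comp (hz : F.IsCompatible z) {W : C} {i j : Fin F.n} {s : W ⟶ F.obj i}
    {t : W ⟶ F.obj j} (h : s ≫ F.hom i = t ≫ F.hom j) : s ≫ z i = t ≫ z j := by
  rw [← pullback.lift_fst s t h, Category.assoc, hz i j, pullback.lift_snd_assoc]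

theorem pullback_snd_comp [E.IsStableUnderBaseChange] (hz : F.IsCompatible z) {T : C} (h : T ⟶ X) :
    (F.pullback h).IsCompatible fun i => pullback.snd h (F.hom i) ≫ z i := fun i j => by
  rw [← Category.assoc, ← Category.assoc]
  refine hz.comp_eq_comp ?_
  rw [Category.assoc, Category.assoc, ← pullback.condition, ← pullback.condition,
    pullback.condition_assoc]

end IsCompatible

variable [HasFiniteCoproducts C]

theorem p₁_comp_eq_p₂_comp_iff {Z : C} {k : (∐ F.obj) ⟶ Z} :
    F.p₁ ≫ k = F.p₂ ≫ k ↔ F.IsCompatible fun i => Sigma.ι F.obj i ≫ k := by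
  refine ⟨fun h i j => ?_, fun h => Sigma.hom_ext _ _ fun ij => ?_⟩
  · simpa [p₁, p₂] using congrArg (Sigma.ι (fun ij : Fin F.n × Fin F.n =>
      Limits.pullback (F.hom ij.1) (F.hom ij.2)) (i, j) ≫ ·) h
  · simpa [p₁, p₂] using h ij.1 ij.2

section IsColimit

variable {F} {Q Z : C} {π : (∐ F.obj) ⟶ Q} {hπ : F.p₁ ≫ π = F.p₂ ≫ π}

theorem hom_ext_of_isColimit (hc : IsColimit (Cofork.ofπ π hπ)) {f g : Q ⟶ Z}
    (h : ∀ i, (Sigma.ι F.obj i ≫ π) ≫ f = (Sigma.ι F.obj i ≫ π) ≫ g) : f = g :=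
  Cofork.IsColimit.hom_ext hc <| Sigma.hom_ext _ _ fun i => by
    simpa only [Category.assoc, Cofork.π_ofπ] using h i

/-- The morphism out of a coequalizer of `∐ Uᵢ ×_X Uⱼ ⇉ ∐ Uᵢ` given by a compatible family. -/
def descOfIsColimit (hc : IsColimit (Cofork.ofπ π hπ)) {z : ∀ i, F.obj i ⟶ Z}
    (hz : F.IsCompatible z) : Q ⟶ Z :=
  Cofork.IsColimit.desc hc (Sigma.desc z) <| F.p₁_comp_eq_p₂_comp_iff.2 <| by simpa using hz

theorem ι_comp_descOfIsColimit (hc : IsColimit (Cofork.ofπ π hπ)) {z : ∀ i, F.obj i ⟶ Z}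
    (hz : F.IsCompatible z) (i : Fin F.n) :
    (Sigma.ι F.obj i ≫ π) ≫ descOfIsColimit hc hz = z i := by
  rw [Category.assoc]
  refine (congrArg (Sigma.ι F.obj i ≫ ·) (Cofork.IsColimit.π_desc' hc _ _)).trans ?_
  exact Sigma.ι_desc _ _

end IsColimit

end EFamily

namespace CoherentSite

variable {C : Type u} [Category.{v} C] [HasPullbacks C] [HasFiniteCoproducts C]
  {S : CoherentSite.{v, u} C}

/-! ### The sieve of an element of `Ω₁(R)` -/

section Sieve

variable {R T : C} {h : T ⟶ R} {a b : S.Omega1 R} {F : EFamily S.E R}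

/-- The sieve of an element `a` of `Ω₁(R)`: the morphisms `h : T ⟶ R` factoring locally through the
members of a family representing `a`. -/
def sieve (a : S.Omega1 R) : Sieve R where
  arrows _ h := S.omegaMap h a = ⊤
  downward_closed {_ _ h} H t := by
    rw [omegaMap_comp, show S.omegaMap h a = ⊤ from H, map_top]

theorem sieve_apply_iff : sieve a h ↔ S.omegaMap h a = ⊤ := Iff.rfl

theorem sieve_omegaMap (h : T ⟶ R) (a : S.Omega1 R) :
    sieve (S.omegaMap h a) = (sieve a).pullback h :=
  Sieve.ext fun _ t => by
    rw [Sieve.pullback_apply, sieve_apply_iff, sieve_apply_iff, omegaMap_comp]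

theorem sieve_top : sieve (⊤ : S.Omega1 R) = ⊤ :=
  Sieve.ext fun _ h => iff_of_true (map_top (S.omegaMap h)) trivial

theorem sieve_inf (a b : S.Omega1 R) : sieve (a ⊓ b) = sieve a ⊓ sieve b :=
  Sieve.ext fun _ _ => by
    rw [Sieve.inter_apply, sieve_apply_iff, map_inf, inf_eq_top_iff, sieve_apply_iff,
      sieve_apply_iff]

theorem sieve_mono : Monotone (sieve : S.Omega1 R → Sieve R) :=
  fun _ _ hab _ h H => top_unique (H.ge.trans (OrderHomClass.mono (S.omegaMap h) hab))

theorem sieve_cls_iff : sieve (S.cls F) h ↔ F.pullback h ∈ S.cov T := by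
  rw [sieve_apply_iff, omegaMap_cls, top_eq]
  refine ⟨fun hF => ?_, fun hF => top_unique (S.cls_le_cls.2 fun _ =>
    S.cov_pullback _ _ hF _ _ _ fun i => IsPullback.of_hasPullback _ _)⟩
  exact S.cov_mono _ _ (fun i => ⟨i, rfl⟩) (S.cov_local _ (F.pullback h) (S.cov_unit T)
    fun _ => S.cls_le_cls.1 hF.ge (0 : Fin 1))

theorem sieve_cls_of_factor (i : Fin F.n) (s : T ⟶ F.obj i) (hs : s ≫ F.hom i = h) :
    sieve (S.cls F) h :=
  sieve_cls_iff.2 (S.cov_of_factor h F i s hs)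

theorem sieve_cls_hom (F : EFamily S.E R) (i : Fin F.n) : sieve (S.cls F) (F.hom i) :=
  sieve_cls_of_factor i (𝟙 _) (Category.id_comp _)

theorem cls_le_iff : S.cls F ≤ b ↔ ∀ i, sieve b (F.hom i) := by
  induction b using S.ind with
  | h G => exact S.cls_le_cls.trans (forall_congr' fun i => sieve_cls_iff.symm)

theorem sieve_le_sieve_iff : sieve a ≤ sieve b ↔ a ≤ b := by
  refine ⟨fun hab => ?_, fun hab => sieve_mono hab⟩
  induction a using S.ind with
  | h F => exact cls_le_iff.2 fun i => hab _ (sieve_cls_hom F i)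

theorem sieve_injective : Function.Injective (sieve : S.Omega1 R → Sieve R) := fun _ _ hab =>
  le_antisymm (sieve_le_sieve_iff.1 hab.le) (sieve_le_sieve_iff.1 hab.ge)

theorem sieve_of_forall_pullback_fst {Q : C} {h : T ⟶ Q} {F : EFamily S.E Q}
    (hF : sieve (S.cls F) h) {k : T ⟶ R}
    (H : ∀ i, sieve b (pullback.fst h (F.hom i) ≫ k)) : sieve b k := by
  induction b using S.ind with
  | h G =>
    exact sieve_cls_iff.2 (S.cov_pullback_local k G (F.pullback h) (sieve_cls_iff.1 hF)
      fun i => sieve_cls_iff.1 (H i))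

theorem cls_eq_sup_single (F : EFamily S.E R) :
    S.cls F = Finset.univ.sup fun i => S.cls (EFamily.single (F.hom i) (F.mem i)) := by
  refine le_antisymm (cls_le_iff.2 fun i => ?_) (Finset.sup_le fun i _ => cls_le_iff.2 fun _ => ?_)
  · exact sieve_mono (Finset.le_sup (f := fun i => S.cls (EFamily.single (F.hom i) (F.mem i)))
      (Finset.mem_univ i)) _ (sieve_cls_hom (EFamily.single (F.hom i) (F.mem i)) (0 : Fin 1))
  · exact sieve_cls_hom F i

end Sieve

/-! ### Descent along the members of a sieve -/

section Descent

variable {R T Z : C} {h : T ⟶ R} {F : EFamily S.E R}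

theorem hom_ext_of_sieve_cls (H : sieve (S.cls F) h) {f g : T ⟶ Z}
    (hfg : ∀ i, pullback.fst h (F.hom i) ≫ f = pullback.fst h (F.hom i) ≫ g) : f = g := by
  refine EFamily.hom_ext_of_isColimit (S.descent _ (sieve_cls_iff.1 H)).some fun i => ?_
  rw [EFamily.ι_toBase]
  exact hfg i

/-- The morphism `T ⟶ Z` glued from a compatible family `zᵢ : Uᵢ ⟶ Z`, for `T ⟶ R` in the sieve of
`{Uᵢ ⟶ R}ᵢ`. -/
def descOfSieveCls (H : sieve (S.cls F) h) {z : ∀ i, F.obj i ⟶ Z} (hz : F.IsCompatible z) :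
    T ⟶ Z :=
  EFamily.descOfIsColimit (S.descent _ (sieve_cls_iff.1 H)).some (hz.pullback_snd_comp h)

theorem comp_descOfSieveCls_eq (H : sieve (S.cls F) h) {z : ∀ i, F.obj i ⟶ Z}
    (hz : F.IsCompatible z) {W : C} {i : Fin F.n} {s : W ⟶ T} {t : W ⟶ F.obj i}
    (hst : s ≫ h = t ≫ F.hom i) : s ≫ descOfSieveCls H hz = t ≫ z i := by
  have hi : pullback.fst h (F.hom i) ≫ descOfSieveCls H hz = pullback.snd h (F.hom i) ≫ z i := by
    have := EFamily.ι_comp_descOfIsColimit (S.descent _ (sieve_cls_iff.1 H)).some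
      (hz.pullback_snd_comp h) i
    rwa [EFamily.ι_toBase] at this
  rw [← pullback.lift_fst s t hst, Category.assoc, hi, pullback.lift_snd_assoc]

theorem comp_descOfSieveCls {T' : C} (t : T' ⟶ T) (H : sieve (S.cls F) h) {z : ∀ i, F.obj i ⟶ Z}
    (hz : F.IsCompatible z) :
    t ≫ descOfSieveCls H hz = descOfSieveCls (Sieve.downward_closed _ H t) hz := by
  refine hom_ext_of_sieve_cls (Sieve.downward_closed _ H t) fun i => ?_
  rw [comp_descOfSieveCls_eq _ hz pullback.condition, ← Category.assoc]
  exact comp_descOfSieveCls_eq H hz ((Category.assoc _ _ _).trans pullback.condition)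

theorem sieve_cls_single_iff {V : C} {f : V ⟶ R} {hf : S.E f} :
    sieve (S.cls (EFamily.single f hf)) h ↔ ∃ s : T ⟶ V, s ≫ f = h := by
  refine ⟨fun H => ?_,
    fun ⟨s, hs⟩ => sieve_cls_of_factor (F := EFamily.single f hf) (0 : Fin 1) s hs⟩
  have := S.mono f hf
  have hz : (EFamily.single f hf).IsCompatible fun _ => 𝟙 V := fun _ _ =>
    congrArg (· ≫ 𝟙 V) ((cancel_mono f).1 pullback.condition)
  have hi : pullback.fst h f ≫ descOfSieveCls H hz = pullback.snd h f :=
    (comp_descOfSieveCls_eq H hz (i := (0 : Fin 1)) pullback.condition).trans (Category.comp_id _)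
  refine ⟨descOfSieveCls H hz, hom_ext_of_sieve_cls H fun _ => ?_⟩
  calc pullback.fst h f ≫ descOfSieveCls H hz ≫ f = pullback.snd h f ≫ f := by
        rw [← Category.assoc, hi]
    _ = pullback.fst h f ≫ h := pullback.condition.symm

end Descent

end CoherentSite

namespace CoherentSite

variable {C : Type u} [Category.{v} C] [HasPullbacks C] [HasFiniteCoproducts C]
  {S : CoherentSite.{v, u} C} {R : C}

/-! ### The object of sections over an element of `Ω₁(R)` -/

/-- A family representing an element of `Ω₁(R)`. -/
def rep (a : S.Omega1 R) : EFamily S.E R :=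
  Quotient.out a

theorem cls_rep (a : S.Omega1 R) : S.cls (rep a) = a :=
  Quotient.out_eq a

theorem sieve_hom {a : S.Omega1 R} {F : EFamily S.E R} (hF : S.cls F = a) (i : Fin F.n) :
    sieve a (F.hom i) :=
  hF ▸ sieve_cls_hom F i

/-- The object of sections over `a ∈ Ω₁(R)`: the coequalizer of `∐ Uᵢ ×_R Uⱼ ⇉ ∐ Uᵢ` for a
representing family `{Uᵢ ⟶ R}`. -/
def sections (a : S.Omega1 R) : C :=
  (S.coequalizer (rep a)).choose

namespace sections

/-- The structure morphism of the coequalizer defining `sections a`. -/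
def π (a : S.Omega1 R) : (∐ (rep a).obj) ⟶ sections a :=
  (S.coequalizer (rep a)).choose_spec.choose

theorem condition (a : S.Omega1 R) : (rep a).p₁ ≫ π a = (rep a).p₂ ≫ π a :=
  (S.coequalizer (rep a)).choose_spec.choose_spec.choose

theorem nonempty_isColimit_π (a : S.Omega1 R) :
    Nonempty (IsColimit (Cofork.ofπ (π a) (condition a))) :=
  (S.coequalizer (rep a)).choose_spec.choose_spec.choose_spec.1

variable {T W Z : C} {a b : S.Omega1 R} {h : T ⟶ R}

/-- The canonical morphism `T ⟶ sections a` for `T ⟶ R` in the sieve of `a`. -/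
def ι (h : T ⟶ R) (H : sieve a h) : T ⟶ sections a :=
  descOfSieveCls (sieve_mono (cls_rep a).ge _ H)
    ((EFamily.p₁_comp_eq_p₂_comp_iff _).1 (condition a))

theorem comp_ι (t : W ⟶ T) (H : sieve a h) :
    t ≫ ι h H = ι (t ≫ h) (Sieve.downward_closed _ H t) :=
  comp_descOfSieveCls _ _ _

theorem comp_ι_eq_ι {h' : W ⟶ R} {H : sieve a h} {H' : sieve a h'} {t : W ⟶ T}
    (e : t ≫ h = h') : t ≫ ι h H = ι h' H' := by
  simp only [comp_ι, e]

theorem comp_ι_eq_comp_ι {T' : C} {h' : T' ⟶ R} {H : sieve a h} {H' : sieve a h'} {t : W ⟶ T}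
    {t' : W ⟶ T'} (e : t ≫ h = t' ≫ h') : t ≫ ι h H = t' ≫ ι h' H' := by
  simp only [comp_ι, e]

theorem ι_rep_hom (a : S.Omega1 R) (i : Fin (rep a).n) :
    ι ((rep a).hom i) (sieve_hom (cls_rep a) i) = Sigma.ι _ i ≫ π a := by
  rw [← Category.id_comp (ι _ _)]
  exact (comp_descOfSieveCls_eq _ _ (t := 𝟙 _) rfl).trans (Category.id_comp _)

theorem hom_ext_of_cls_eq {F : EFamily S.E R} (hF : S.cls F = a) {f g : sections a ⟶ Z}
    (hfg : ∀ i, ι (F.hom i) (sieve_hom hF i) ≫ f = ι (F.hom i) (sieve_hom hF i) ≫ g) :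
    f = g := by
  refine EFamily.hom_ext_of_isColimit (nonempty_isColimit_π a).some fun i => ?_
  rw [← ι_rep_hom]
  refine hom_ext_of_sieve_cls (sieve_mono hF.ge _ (sieve_hom (cls_rep a) i)) fun j => ?_
  rw [← Category.assoc, ← Category.assoc,
    comp_ι_eq_comp_ι (H' := sieve_hom hF j) pullback.condition, Category.assoc, Category.assoc,
    hfg]

theorem hom_ext {f g : sections a ⟶ Z}
    (hfg : ∀ {T : C} (h : T ⟶ R) (H : sieve a h), ι h H ≫ f = ι h H ≫ g) : f = g :=
  hom_ext_of_cls_eq (cls_rep a) fun _ => hfg _ _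

section Desc

variable (z : ∀ (T : C) (h : T ⟶ R), sieve a h → (T ⟶ Z))
  (hz : ∀ (T W : C) (t : W ⟶ T) (h : T ⟶ R) (H : sieve a h),
    t ≫ z T h H = z W (t ≫ h) (Sieve.downward_closed _ H t))

include hz in
theorem isCompatible_of_comp_eq :
    (rep a).IsCompatible fun i => z _ ((rep a).hom i) (sieve_hom (cls_rep a) i) := fun i j => by
  simp only [hz, pullback.condition]

/-- The morphism out of `sections a` given by a natural family of morphisms `T ⟶ Z` on the sieve
of `a`. -/
def desc : sections a ⟶ Z :=
  EFamily.descOfIsColimit (nonempty_isColimit_π a).some (isCompatible_of_comp_eq z hz)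

theorem ι_desc (h : T ⟶ R) (H : sieve a h) : ι h H ≫ desc z hz = z T h H := by
  refine hom_ext_of_sieve_cls (sieve_mono (cls_rep a).ge _ H) fun i => ?_
  rw [← Category.assoc,
    comp_ι_eq_comp_ι (H' := sieve_hom (cls_rep a) i) pullback.condition, Category.assoc, ι_rep_hom,
    desc, EFamily.ι_comp_descOfIsColimit, hz, hz]
  simp only [pullback.condition]

end Desc

section DescFamily

variable {F : EFamily S.E R} (hF : S.cls F = a) {z : ∀ i, F.obj i ⟶ Z} (hz : F.IsCompatible z)

/-- The morphism out of `sections a` given by a compatible family of morphisms on the members of a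
family representing `a`. -/
def descFamily : sections a ⟶ Z :=
  desc (fun _ _ H => descOfSieveCls (sieve_mono hF.ge _ H) hz) fun _ _ _ _ _ =>
    comp_descOfSieveCls _ _ _

theorem comp_ι_descFamily {H : sieve a h} {i : Fin F.n} {s : W ⟶ T} {t : W ⟶ F.obj i}
    (hst : s ≫ h = t ≫ F.hom i) : s ≫ ι h H ≫ descFamily hF hz = t ≫ z i := by
  have : ι h H ≫ descFamily hF hz = descOfSieveCls (sieve_mono hF.ge _ H) hz :=
    ι_desc (fun _ _ H => descOfSieveCls (sieve_mono hF.ge _ H) hz)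
      (fun _ _ _ _ _ => comp_descOfSieveCls _ _ _) h H
  rw [this, comp_descOfSieveCls_eq _ hz hst]

theorem ι_descFamily (i : Fin F.n) :
    ι (F.hom i) (sieve_hom hF i) ≫ descFamily hF hz = z i := by
  simpa only [Category.id_comp] using
    comp_ι_descFamily hF hz (H := sieve_hom hF i) (s := 𝟙 _) (t := 𝟙 _) rfl

end DescFamily

theorem nonempty_isColimit_of_cls_eq {F : EFamily S.E R} (hF : S.cls F = a)
    {p : (∐ F.obj) ⟶ sections a} (hp : ∀ i, Sigma.ι F.obj i ≫ p = ι (F.hom i) (sieve_hom hF i))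
    (h : F.p₁ ≫ p = F.p₂ ≫ p) : Nonempty (IsColimit (Cofork.ofπ p h)) := by
  refine ⟨Cofork.IsColimit.mk _
    (fun s => descFamily hF (F.p₁_comp_eq_p₂_comp_iff.1 s.condition)) (fun s => ?_)
    fun s m hm => hom_ext_of_cls_eq hF fun i => ?_⟩
  · refine Sigma.hom_ext _ _ fun i => ?_
    rw [Cofork.π_ofπ, ← Category.assoc, hp, ι_descFamily]
  · rw [ι_descFamily, ← hp, Category.assoc]
    exact congrArg _ hm

/-- The canonical morphism `sections a ⟶ R`. -/
def toBase (a : S.Omega1 R) : sections a ⟶ R :=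
  desc (fun _ h _ => h) fun _ _ _ _ _ => rfl

theorem ι_toBase (h : T ⟶ R) (H : sieve a h) : ι h H ≫ toBase a = h :=
  ι_desc _ (fun _ _ _ _ _ => rfl) h H

/-- The morphism `sections a ⟶ sections b` for `a ≤ b`. -/
def map (hab : a ≤ b) : sections a ⟶ sections b :=
  desc (fun _ h H => ι h (sieve_mono hab _ H)) fun _ _ _ _ _ => comp_ι _ _

theorem ι_map (hab : a ≤ b) (h : T ⟶ R) (H : sieve a h) :
    ι h H ≫ map hab = ι h (sieve_mono hab _ H) :=
  ι_desc (fun _ h H => ι h (sieve_mono hab _ H)) (fun _ _ _ _ _ => comp_ι _ _) h H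

theorem map_comp_toBase (hab : a ≤ b) : map hab ≫ toBase b = toBase a :=
  hom_ext fun h H => by rw [← Category.assoc, ι_map, ι_toBase, ι_toBase]

theorem toBase_comp_ι_id (H : sieve a (𝟙 R)) : toBase a ≫ ι (𝟙 R) H = 𝟙 _ :=
  hom_ext fun h H' => by
    rw [← Category.assoc, ι_toBase, comp_ι]
    simp only [Category.comp_id]

variable (S R) in
/-- The functor `a ↦ sections a`. -/
def functor : S.Omega1 R ⥤ C where
  obj a := sections a
  map f := map (leOfHom f)
  map_id a := hom_ext fun h H => by rw [ι_map, Category.comp_id]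
  map_comp f g := hom_ext fun h H => by rw [← Category.assoc, ι_map, ι_map, ι_map]

section BaseChange

variable {A : C} (f : A ⟶ R) {c : S.Omega1 A} (hc : c ≤ S.omegaMap f a)

include hc in
theorem sieve_comp_of_le_omegaMap {h : T ⟶ A} (H : sieve c h) : sieve a (h ≫ f) := by
  have : sieve (S.omegaMap f a) h := sieve_mono hc _ H
  rwa [sieve_omegaMap] at this

/-- The morphism `sections c ⟶ sections a` over `f : A ⟶ R`, where `c ∈ Ω₁(A)` lies below the
base change of `a ∈ Ω₁(R)`. -/
def baseChange : sections c ⟶ sections a :=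
  desc (fun _ h H => ι (h ≫ f) (sieve_comp_of_le_omegaMap f hc H)) fun _ _ _ _ _ => by
    simp only [comp_ι, Category.assoc]

theorem ι_baseChange {h : T ⟶ A} (H : sieve c h) :
    ι h H ≫ baseChange f hc = ι (h ≫ f) (sieve_comp_of_le_omegaMap f hc H) :=
  ι_desc (fun _ h H => ι (h ≫ f) (sieve_comp_of_le_omegaMap f hc H)) _ h H

end BaseChange

theorem exists_comp_eq_of_mono {A B : C} (j : A ⟶ B) [Mono j] (m : sections a ⟶ B)
    (hm : ∀ (T : C) (h : T ⟶ R) (H : sieve a h), ∃ s, s ≫ j = ι h H ≫ m) :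
    ∃ g, g ≫ j = m := by
  choose s hs using hm
  have hs_comp (T W : C) (t : W ⟶ T) (h : T ⟶ R) (H : sieve a h) :
      t ≫ s T h H = s W (t ≫ h) (Sieve.downward_closed _ H t) := by
    rw [← cancel_mono j, Category.assoc, hs, hs, ← Category.assoc, comp_ι]
  exact ⟨desc s hs_comp, hom_ext fun h H => by rw [← Category.assoc, ι_desc, hs]⟩

theorem mono_toBase_of_cls_single_eq {V : C} {f : V ⟶ R} {hf : S.E f}
    (ha : S.cls (EFamily.single f hf) = a) : Mono (toBase a) := by
  subst ha
  have := S.mono f hf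
  obtain ⟨r, hr⟩ := exists_comp_eq_of_mono f (toBase (S.cls (EFamily.single f hf))) fun _ h H => by
    rw [ι_toBase]
    exact sieve_cls_single_iff.1 H
  have hfa : sieve (S.cls (EFamily.single f hf)) f :=
    sieve_cls_single_iff.2 ⟨𝟙 V, Category.id_comp f⟩
  have hrf : r ≫ ι f hfa = 𝟙 _ := hom_ext fun h H => by
    rw [← Category.assoc, comp_ι]
    simp only [Category.assoc, hr, ι_toBase, Category.comp_id]
  have : IsSplitMono r := ⟨⟨_, hrf⟩⟩
  exact hr ▸ mono_comp r f

/-! ### Gluing over a finite join -/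

theorem exists_cls_eq_sup {κ : Type*} (a : κ → S.Omega1 R) (t : Finset κ) :
    ∃ G : EFamily S.E R, S.cls G = t.sup a ∧ ∀ k, ∃ i, sieve (a i) (G.hom k) := by
  classical
  induction t using Finset.induction_on with
  | empty => exact ⟨EFamily.empty S.E R, rfl, fun k => k.elim0⟩
  | insert i t _ ih =>
    obtain ⟨G, hG, hGa⟩ := ih
    refine ⟨(rep (a i)).union G, ?_, EFamily.union_forall
      (p := fun _ h => ∃ j, sieve (a j) h) (fun k => ⟨i, sieve_hom (cls_rep _) k⟩) hGa⟩
    rw [← cls_sup_cls, cls_rep, hG, Finset.sup_insert]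

theorem existsUnique_glue {κ : Type*} [Fintype κ] {a : κ → S.Omega1 R}
    (hb : Finset.univ.sup a = b) (hab : ∀ i, a i ≤ b) (z : ∀ i, sections (a i) ⟶ Z)
    (hz : ∀ i j {T : C} (h : T ⟶ R) (Hi : sieve (a i) h) (Hj : sieve (a j) h),
      ι h Hi ≫ z i = ι h Hj ≫ z j) :
    ∃! m : sections b ⟶ Z, ∀ i, map (hab i) ≫ m = z i := by
  have hz_comp {i j : κ} {T T' W : C} {h : T ⟶ R} {h' : T' ⟶ R} (Hi : sieve (a i) h)
      (Hj : sieve (a j) h') {t : W ⟶ T} {t' : W ⟶ T'} (e : t ≫ h = t' ≫ h') :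
      t ≫ ι h Hi ≫ z i = t' ≫ ι h' Hj ≫ z j := by
    rw [← Category.assoc, ← Category.assoc, comp_ι, comp_ι,
      hz i j _ _ (e ▸ Sieve.downward_closed _ Hj t')]
    simp only [e]
  obtain ⟨G, hG, hGa⟩ := exists_cls_eq_sup a Finset.univ
  choose i hi using hGa
  have hG_compat : G.IsCompatible fun k => ι (G.hom k) (hi k) ≫ z (i k) :=
    fun k l => hz_comp (hi k) (hi l) pullback.condition
  refine ⟨descFamily (hG.trans hb) hG_compat, fun j => hom_ext fun h H => ?_, fun m hm => ?_⟩
  · rw [← Category.assoc, ι_map]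
    refine hom_ext_of_sieve_cls (sieve_mono ((hab j).trans (hG.trans hb).ge) _ H) fun k => ?_
    rw [comp_ι_descFamily _ hG_compat pullback.condition, hz_comp H (hi k) pullback.condition]
  · refine hom_ext_of_cls_eq (hG.trans hb) fun k => ?_
    rw [ι_descFamily, ← hm, ← Category.assoc, ι_map]

end sections

/-! ### The support -/

section Support

variable {T V : C} {a c : S.Omega1 R}

theorem sieve_cls_along_iff {F : EFamily S.E R} (hF : S.cls F = a) (f : V ⟶ sections a)
    (hf : S.E f) {h : T ⟶ R} (H : sieve a h) :
    sieve (S.cls (F.along (fun i => sections.ι (F.hom i) (sieve_hom hF i)) f hf)) h ↔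
      sieve (S.cls (EFamily.single f hf)) (sections.ι h H) := by
  refine ⟨fun hk => sieve_of_forall_pullback_fst hk fun i => sieve_cls_single_iff.2 ?_,
    fun hk => ?_⟩
  · let q : pullback (sections.ι (F.hom i) (sieve_hom hF i)) f ⟶ F.obj i := pullback.fst _ _
    let r : pullback h (q ≫ F.hom i) ⟶ _ := pullback.snd _ _
    have hr : pullback.fst h (q ≫ F.hom i) ≫ h = (r ≫ q) ≫ F.hom i := by
      rw [pullback.condition, Category.assoc]
    refine ⟨r ≫ pullback.snd _ f, ?_⟩
    calc (r ≫ pullback.snd _ f) ≫ f = (r ≫ q) ≫ sections.ι (F.hom i) (sieve_hom hF i) := by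
          rw [Category.assoc, Category.assoc, pullback.condition]
      _ = pullback.fst h (q ≫ F.hom i) ≫ sections.ι h H := (sections.comp_ι_eq_comp_ι hr).symm
  · obtain ⟨s, hs⟩ := sieve_cls_single_iff.1 hk
    refine sieve_of_forall_pullback_fst (F := F) (sieve_mono hF.ge _ H) fun i => ?_
    refine sieve_cls_of_factor (F := F.along _ f hf) i
      (pullback.lift (pullback.snd h (F.hom i)) (pullback.fst h (F.hom i) ≫ s) ?_) ?_
    · rw [Category.assoc, hs]
      exact sections.comp_ι_eq_comp_ι pullback.condition.symm
    · exact (pullback.lift_fst_assoc _ _ _ _).trans pullback.condition.symm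

theorem omegaMap_cls_along {F : EFamily S.E R} (hF : S.cls F = a) (f : V ⟶ sections a)
    (hf : S.E f) (h : T ⟶ R) (H : sieve a h) :
    S.omegaMap h (S.cls (F.along (fun i => sections.ι (F.hom i) (sieve_hom hF i)) f hf)) =
      S.omegaMap (sections.ι h H) (S.cls (EFamily.single f hf)) := by
  refine sieve_injective (Sieve.ext fun _ t => ?_)
  rw [sieve_omegaMap, sieve_omegaMap, Sieve.pullback_apply, Sieve.pullback_apply,
    sieve_cls_along_iff hF f hf (Sieve.downward_closed _ H t), sections.comp_ι]

theorem cls_along_le {A : C} (F : EFamily S.E R) (g : ∀ i, F.obj i ⟶ A) (f : V ⟶ A)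
    (hf : S.E f) : S.cls (F.along g f hf) ≤ S.cls F :=
  S.cls_le_cls_of_factor fun i => ⟨i, pullback.fst _ _, rfl⟩

/-- The support in `Ω₁(R)` of an element of `Ω₁(sections a)`. It is characterized by
`omegaMap_supp`. -/
def supp (a : S.Omega1 R) (b : S.Omega1 (sections a)) : S.Omega1 R :=
  Finset.univ.sup fun k => S.cls ((rep a).along
    (fun i => sections.ι ((rep a).hom i) (sieve_hom (cls_rep a) i)) ((rep b).hom k) ((rep b).mem k))

theorem supp_le (a : S.Omega1 R) (b : S.Omega1 (sections a)) : supp a b ≤ a :=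
  Finset.sup_le fun _ _ => (cls_along_le _ _ _ _).trans (cls_rep a).le

theorem omegaMap_supp (b : S.Omega1 (sections a)) (h : T ⟶ R) (H : sieve a h) :
    S.omegaMap h (supp a b) = S.omegaMap (sections.ι h H) b := by
  conv_rhs => rw [← cls_rep b, cls_eq_sup_single, map_finset_sup]
  rw [supp, map_finset_sup]
  exact Finset.sup_congr rfl fun k _ => omegaMap_cls_along (cls_rep a) _ _ h H

theorem supp_eq_of_omegaMap_eq {b : S.Omega1 (sections a)} (hc : c ≤ a)
    (hcb : ∀ {T : C} (h : T ⟶ R) (H : sieve a h),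
      S.omegaMap h c = S.omegaMap (sections.ι h H) b) : supp a b = c := by
  refine sieve_injective (Sieve.ext fun _ h => ?_)
  by_cases H : sieve a h
  · rw [sieve_apply_iff, sieve_apply_iff, hcb h H, omegaMap_supp b h H]
  · exact iff_of_false (fun h' => H (sieve_mono (supp_le a b) _ h'))
      fun h' => H (sieve_mono hc _ h')

theorem supp_cls_single {F : EFamily S.E R} (hF : S.cls F = a) (f : V ⟶ sections a) (hf : S.E f) :
    supp a (S.cls (EFamily.single f hf)) =
      S.cls (F.along (fun i => sections.ι (F.hom i) (sieve_hom hF i)) f hf) :=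
  supp_eq_of_omegaMap_eq ((cls_along_le _ _ _ _).trans hF.le) (omegaMap_cls_along hF f hf)

theorem supp_sup (b b' : S.Omega1 (sections a)) : supp a (b ⊔ b') = supp a b ⊔ supp a b' :=
  supp_eq_of_omegaMap_eq (sup_le (supp_le a b) (supp_le a b')) fun h H => by
    rw [map_sup, map_sup, omegaMap_supp, omegaMap_supp]

theorem supp_inf (b b' : S.Omega1 (sections a)) : supp a (b ⊓ b') = supp a b ⊓ supp a b' :=
  supp_eq_of_omegaMap_eq (inf_le_left.trans (supp_le a b)) fun h H => by
    rw [map_inf, map_inf, omegaMap_supp, omegaMap_supp]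

theorem supp_top (a : S.Omega1 R) : supp a ⊤ = a :=
  supp_eq_of_omegaMap_eq le_rfl fun h H => by rw [map_top, sieve_apply_iff.1 H]

theorem supp_bot (a : S.Omega1 R) : supp a ⊥ = ⊥ :=
  supp_eq_of_omegaMap_eq bot_le fun h H => by rw [map_bot, map_bot]

theorem supp_omegaMap_map {a' : S.Omega1 R} (h : a' ≤ a) (b : S.Omega1 (sections a)) :
    supp a' (S.omegaMap (sections.map h) b) = supp a b ⊓ a' :=
  supp_eq_of_omegaMap_eq inf_le_right fun k H => by
    rw [map_inf, sieve_apply_iff.1 H, inf_top_eq, ← omegaMap_comp, sections.ι_map, omegaMap_supp]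

theorem supp_omegaMap_toBase (a c : S.Omega1 R) :
    supp a (S.omegaMap (sections.toBase a) c) = c ⊓ a :=
  supp_eq_of_omegaMap_eq inf_le_right fun k H => by
    rw [map_inf, sieve_apply_iff.1 H, inf_top_eq, ← omegaMap_comp, sections.ι_toBase]

theorem exists_comp_eq_map_of_le_supp {A : C} {a' : S.Omega1 R} (h : a' ≤ a) (j : A ⟶ sections a)
    (hj : S.E j) (hle : a' ≤ supp a (S.cls (EFamily.single j hj))) :
    ∃ g : sections a' ⟶ A, g ≫ j = sections.map h := by
  have := S.mono j hj
  refine sections.exists_comp_eq_of_mono j _ fun _ k H => (sieve_cls_single_iff (hf := hj)).1 ?_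
  rw [sections.ι_map, sieve_apply_iff, ← omegaMap_supp]
  exact sieve_mono hle _ H

end Support

end CoherentSite

/-! ### Gluing morphisms out of a `Cᵒᵖ`-valued sheaf -/

namespace IsOpSheaf

variable {C : Type u} [Category.{v} C] [HasFiniteCoproducts C]
  {X : Type w} [TopologicalSpace X] [SpectralSpace X] {O : CompactOpens X ⥤ C}
  {n : ℕ} {W : Fin n → CompactOpens X} {V : CompactOpens X} {Z : C}

theorem hom_ext (hO : IsOpSheaf O) (hV : Finset.univ.sup W = V) (hW : ∀ i, W i ≤ V)
    {f g : O.obj V ⟶ Z}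
    (h : ∀ i, O.map (homOfLE (hW i)) ≫ f = O.map (homOfLE (hW i)) ≫ g) : f = g := by
  subst hV
  obtain ⟨_, ⟨hc⟩⟩ := hO n W
  refine Cofork.IsColimit.hom_ext hc (Sigma.hom_ext _ _ fun i => ?_)
  rw [Cofork.π_ofπ, Sigma.ι_desc_assoc, Sigma.ι_desc_assoc]
  exact h i

theorem existsUnique_glue (hO : IsOpSheaf O) (hV : Finset.univ.sup W = V) (hW : ∀ i, W i ≤ V)
    (z : ∀ i, O.obj (W i) ⟶ Z)
    (hz : ∀ i j, O.map (homOfLE (inf_le_left : W i ⊓ W j ≤ W i)) ≫ z i =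
      O.map (homOfLE (inf_le_right : W i ⊓ W j ≤ W j)) ≫ z j) :
    ∃! m : O.obj V ⟶ Z, ∀ i, O.map (homOfLE (hW i)) ≫ m = z i := by
  suffices h : ∃ m : O.obj V ⟶ Z, ∀ i, O.map (homOfLE (hW i)) ≫ m = z i from
    existsUnique_of_exists_of_unique h fun m m' hm hm' =>
      hO.hom_ext hV hW fun i => (hm i).trans (hm' i).symm
  subst hV
  obtain ⟨_, ⟨hc⟩⟩ := hO n W
  obtain ⟨m, hm⟩ := Cofork.IsColimit.desc' hc (Sigma.desc z) (Sigma.hom_ext _ _ fun ij => by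
    simpa using hz ij.1 ij.2)
  refine ⟨m, fun i => ?_⟩
  simpa using congrArg (Sigma.ι (fun i => O.obj (W i)) i ≫ ·) hm

theorem of_existsUnique_glue
    (hO : ∀ {n : ℕ} (W : Fin n → CompactOpens X) {Z : C} (z : ∀ i, O.obj (W i) ⟶ Z),
      (∀ i j, O.map (homOfLE (inf_le_left : W i ⊓ W j ≤ W i)) ≫ z i =
        O.map (homOfLE (inf_le_right : W i ⊓ W j ≤ W j)) ≫ z j) →
      ∃! m : O.obj (Finset.univ.sup W) ⟶ Z,
        ∀ i, O.map (homOfLE (Finset.le_sup (f := W) (Finset.mem_univ i))) ≫ m = z i) :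
    IsOpSheaf O := by
  refine fun n W => ⟨Sigma.hom_ext _ _ fun ij => ?_, ⟨Cofork.IsColimit.mk' _ fun s => ?_⟩⟩
  · simp only [Sigma.ι_desc_assoc, Category.assoc, Sigma.ι_desc, ← Functor.map_comp]
    rfl
  · have hs (i j) : O.map (homOfLE (inf_le_left : W i ⊓ W j ≤ W i)) ≫
        Sigma.ι (fun i => O.obj (W i)) i ≫ s.π =
        O.map (homOfLE (inf_le_right : W i ⊓ W j ≤ W j)) ≫
          Sigma.ι (fun i => O.obj (W i)) j ≫ s.π := by
      simpa using congrArg (Sigma.ι (fun ij : Fin n × Fin n => O.obj (W ij.1 ⊓ W ij.2)) (i, j) ≫ ·)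
        s.condition
    have hm := hO W (fun i => Sigma.ι (fun i => O.obj (W i)) i ≫ s.π) hs
    refine ⟨hm.choose, Sigma.hom_ext _ _ fun i => ?_, fun {m} hm' => hm.unique (fun i => ?_)
      hm.choose_spec.1⟩
    · rw [Cofork.π_ofπ, Sigma.ι_desc_assoc]
      exact hm.choose_spec.1 i
    · rw [← hm', Cofork.π_ofπ, Sigma.ι_desc_assoc]

end IsOpSheaf

/-! ### The spectrum -/

namespace CoherentSite

variable {C : Type u} [Category.{v} C] [HasPullbacks C] [HasFiniteCoproducts C]
  (S : CoherentSite.{v, u} C) (R : C) [Small.{w} (S.Omega1 R)]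

/-- The structure sheaf of the spectrum: `sections`, along the identification of `Ω₁(R)` with the
quasi-compact open subsets. -/
abbrev structureSheaf : CompactOpens (IdealSpectrum.{w} (S.Omega1 R)) ⥤ C :=
  (IdealSpectrum.basic (S.Omega1 R)).symm.monotone.functor ⋙ sections.functor S R

theorem isOpSheaf_structureSheaf : IsOpSheaf (structureSheaf.{w} S R) := by
  refine IsOpSheaf.of_existsUnique_glue fun W Z z hz => ?_
  let a (U : CompactOpens (IdealSpectrum.{w} (S.Omega1 R))) : S.Omega1 R :=
    (IdealSpectrum.basic (S.Omega1 R)).symm U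
  have ha {U V : CompactOpens _} (h : U ≤ V) : a U ≤ a V :=
    (IdealSpectrum.basic _).symm.monotone h
  let z' (i) : sections (a (W i)) ⟶ Z := z i
  have hz' (i j) : sections.map (ha inf_le_left) ≫ z' i = sections.map (ha inf_le_right) ≫ z' j :=
    hz i j
  refine sections.existsUnique_glue (map_finset_sup (IdealSpectrum.basic _).symm _ W).symm
    (fun i => ha (Finset.le_sup (f := W) (Finset.mem_univ i))) z' fun i j _ h Hi Hj => ?_
  have H : sieve (a (W i ⊓ W j)) h := by
    have : a (W i ⊓ W j) = a (W i) ⊓ a (W j) := map_inf _ _ _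
    rw [this, sieve_inf]
    exact ⟨Hi, Hj⟩
  rw [← sections.ι_map (ha inf_le_left) h H, ← sections.ι_map (ha inf_le_right) h H,
    Category.assoc, Category.assoc, hz']

/-- The support morphism of the spectrum. -/
def supportHom (U : CompactOpens (IdealSpectrum.{w} (S.Omega1 R))) :
    BoundedLatticeHom (S.Omega1 ((structureSheaf S R).obj U)) (Set.Iic U) where
  toFun b := ⟨IdealSpectrum.basic _ (supp _ b), (OrderIso.le_symm_apply _).1 (supp_le _ b)⟩
  map_sup' b c := Subtype.ext <| (congrArg _ (supp_sup b c)).trans (map_sup _ _ _)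
  map_inf' b c := Subtype.ext <| (congrArg _ (supp_inf b c)).trans (map_inf _ _ _)
  map_top' := Subtype.ext <| (congrArg _ (supp_top _)).trans (OrderIso.apply_symm_apply _ _)
  map_bot' := Subtype.ext <| (congrArg _ (supp_bot _)).trans (map_bot _)

/-- The spectrum of `R`, as a weak `C`-scheme. -/
def spec : WeakScheme.{w} S where
  carrier := IdealSpectrum.{w} (S.Omega1 R)
  sheaf := structureSheaf S R
  isOpSheaf := isOpSheaf_structureSheaf S R
  support := supportHom S R
  support_map h b :=
    (congrArg _ (supp_omegaMap_map ((IdealSpectrum.basic _).symm.monotone h) b)).trans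
      ((map_inf _ _ _).trans (congrArg _ (OrderIso.apply_symm_apply _ _)))
  factor h _ j hj hV :=
    exists_comp_eq_map_of_le_supp ((IdealSpectrum.basic _).symm.monotone h) j hj
      ((OrderIso.symm_apply_le _).2 hV)

namespace spec

/-- The quasi-compact open subset of the spectrum given by an element of `Ω₁(R)`. -/
def basicOpen : S.Omega1 R ≃o CompactOpens (spec.{w} S R).carrier :=
  IdealSpectrum.basic (S.Omega1 R)

variable {S R} {T V : C} {h : T ⟶ R} {U : CompactOpens (spec.{w} S R).carrier}

/-- The canonical morphism from the sections over `U` to `R`. -/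
def toBase (U : CompactOpens (spec.{w} S R).carrier) : (spec.{w} S R).sheaf.obj U ⟶ R :=
  sections.toBase _

/-- The canonical morphism `T ⟶ 𝒪(U)` for `T ⟶ R` in the sieve of `U`. -/
def ι (h : T ⟶ R) (H : sieve ((basicOpen S R).symm U) h) : T ⟶ (spec.{w} S R).sheaf.obj U :=
  sections.ι h H

theorem ι_toBase (H : sieve ((basicOpen S R).symm U) h) : ι h H ≫ toBase U = h :=
  sections.ι_toBase h H

theorem comp_ι_eq_comp_ι {W T' : C} {h' : T' ⟶ R} {H : sieve ((basicOpen S R).symm U) h}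
    {H' : sieve ((basicOpen S R).symm U) h'} {t : W ⟶ T} {t' : W ⟶ T'} (e : t ≫ h = t' ≫ h') :
    t ≫ ι h H = t' ≫ ι h' H' :=
  sections.comp_ι_eq_comp_ι e

theorem ι_map {U' : CompactOpens (spec.{w} S R).carrier} (hU : U ≤ U')
    (H : sieve ((basicOpen S R).symm U) h) :
    ι h H ≫ (spec S R).sheaf.map (homOfLE hU) =
      ι h (sieve_mono ((basicOpen S R).symm.monotone hU) _ H) :=
  sections.ι_map ((basicOpen S R).symm.monotone hU) h H

theorem map_toBase {U' : CompactOpens (spec.{w} S R).carrier} (hU : U ≤ U') :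
    (spec S R).sheaf.map (homOfLE hU) ≫ toBase U' = toBase U :=
  sections.map_comp_toBase ((basicOpen S R).symm.monotone hU)

theorem toBase_comp_ι_id (H : sieve ((basicOpen.{w} S R).symm U) (𝟙 R)) :
    toBase U ≫ ι (𝟙 R) H = 𝟙 _ :=
  sections.toBase_comp_ι_id H

theorem mono_toBase_basicOpen_single (f : V ⟶ R) (hf : S.E f) :
    Mono (toBase (basicOpen.{w} S R (S.cls (EFamily.single f hf)))) :=
  sections.mono_toBase_of_cls_single_eq ((basicOpen S R).symm_apply_apply _).symm

theorem support_omegaMap_toBase (U : CompactOpens (spec.{w} S R).carrier) (a : S.Omega1 R) :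
    ((spec S R).support U (S.omegaMap (toBase U) a) : CompactOpens (spec S R).carrier) =
      basicOpen S R a ⊓ U := by
  calc basicOpen S R (supp ((basicOpen S R).symm U) (S.omegaMap (sections.toBase _) a))
      = basicOpen S R (a ⊓ (basicOpen S R).symm U) := by rw [supp_omegaMap_toBase]
    _ = basicOpen S R a ⊓ U := by rw [map_inf, OrderIso.apply_symm_apply]

theorem sieve_symm_basicOpen_hom (F : EFamily S.E R) (i : Fin F.n) :
    sieve ((basicOpen.{w} S R).symm (basicOpen S R (S.cls F))) (F.hom i) :=
  sieve_hom ((basicOpen S R).symm_apply_apply _).symm i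

/-- The morphism exhibiting the sections over `{Uᵢ ⟶ R}` as the coequalizer of
`∐ Uᵢ ×_R Uⱼ ⇉ ∐ Uᵢ`. -/
def π (F : EFamily S.E R) : (∐ F.obj) ⟶ (spec.{w} S R).sheaf.obj (basicOpen S R (S.cls F)) :=
  Sigma.desc fun i => ι (F.hom i) (sieve_symm_basicOpen_hom F i)

theorem ι_π (F : EFamily S.E R) (i : Fin F.n) :
    Sigma.ι F.obj i ≫ π.{w} F = ι (F.hom i) (sieve_symm_basicOpen_hom F i) :=
  Sigma.ι_desc _ _

theorem π_condition (F : EFamily S.E R) : F.p₁ ≫ π.{w} F = F.p₂ ≫ π.{w} F :=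
  F.p₁_comp_eq_p₂_comp_iff.2 fun i j => by
    simp only [ι_π]
    exact comp_ι_eq_comp_ι pullback.condition

variable (S R) in
/-- The presentation of `spec S R` as the spectrum of `R`. -/
def spectrumData : SpectrumData S R (spec.{w} S R) where
  homeo := IdealSpectrum.homeo (S.Omega1 R)
  basic := basicOpen S R
  mem_basic := IdealSpectrum.mem_basic
  π := π
  condition := π_condition
  isColimit F := (sections.nonempty_isColimit_of_cls_eq ((basicOpen S R).symm_apply_apply _).symm
    (ι_π F) (π_condition F)).some
  π_map F G h i j := by
    rw [← Category.assoc (Sigma.ι _ _), ι_π, ι_π, ι_map]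
    exact comp_ι_eq_comp_ι pullback.condition
  support_basic F V f hf := by
    simp only [ι_π]
    exact congrArg (basicOpen S R) (supp_cls_single ((basicOpen S R).symm_apply_apply _).symm f hf)

theorem sieve_symm_basicOpen_top_id : sieve ((basicOpen.{w} S R).symm ⊤) (𝟙 R) := by
  rw [map_top, sieve_top]
  trivial

theorem canonical_spectrumData :
    (spectrumData.{w} S R).canonical = ι (𝟙 R) sieve_symm_basicOpen_top_id := by
  refine (Category.assoc _ _ _).symm.trans ?_
  exact (congrArg (· ≫ _) (ι_π (EFamily.unit S.E R) (0 : Fin 1))).trans (ι_map _ _)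

theorem canonical_comp_toBase : (spectrumData.{w} S R).canonical ≫ toBase ⊤ = 𝟙 R :=
  (congrArg (· ≫ toBase ⊤) canonical_spectrumData).trans (ι_toBase _)

theorem toBase_comp_canonical : toBase ⊤ ≫ (spectrumData.{w} S R).canonical = 𝟙 _ :=
  (congrArg (toBase ⊤ ≫ ·) canonical_spectrumData).trans (toBase_comp_ι_id _)

end spec

end CoherentSite

/-! ### Morphisms out of global sections -/

namespace WeakScheme

open CoherentSite

variable {C : Type u} [Category.{v} C] [HasPullbacks C] [HasFiniteCoproducts C]
  {S : CoherentSite.{v, u} C} {X : WeakScheme.{w} S} {R : C}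

theorem sheaf_map_map_assoc {U V W : CompactOpens X.carrier} (hUV : U ≤ V) (hVW : V ≤ W) {Z : C}
    (f : X.sheaf.obj W ⟶ Z) :
    X.sheaf.map (homOfLE hUV) ≫ X.sheaf.map (homOfLE hVW) ≫ f =
      X.sheaf.map (homOfLE (hUV.trans hVW)) ≫ f := by
  rw [← Category.assoc, ← Functor.map_comp, homOfLE_comp]

variable (g : X.sheaf.obj ⊤ ⟶ R)

/-- The morphism `𝒪(W) ⟶ R` obtained from `Γ(X) ⟶ R`. -/
def structureMap (W : CompactOpens X.carrier) : X.sheaf.obj W ⟶ R :=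
  X.sheaf.map (homOfLE le_top) ≫ g

theorem map_structureMap {V W : CompactOpens X.carrier} (h : V ≤ W) :
    X.sheaf.map (homOfLE h) ≫ structureMap g W = structureMap g V :=
  sheaf_map_map_assoc h le_top g

theorem structureMap_top : structureMap g ⊤ = g :=
  (congrArg (· ≫ g) (X.sheaf.map_id ⊤)).trans (Category.id_comp g)

/-- The lattice homomorphism `Ω₁(R) ⟶ Ω_c(X)` induced by `Γ(X) ⟶ R` and the support morphism. -/
def inverseImage : BoundedLatticeHom (S.Omega1 R) (CompactOpens X.carrier) where
  toFun a := X.support ⊤ (S.omegaMap g a)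
  map_sup' a b := by
    rw [map_sup, map_sup]
    rfl
  map_inf' a b := by
    rw [map_inf, map_inf]
    rfl
  map_top' := by
    rw [map_top, map_top]
    rfl
  map_bot' := by
    rw [map_bot, map_bot]
    rfl

theorem support_structureMap (W : CompactOpens X.carrier) (a : S.Omega1 R) :
    (X.support W (S.omegaMap (structureMap g W) a) : CompactOpens X.carrier) =
      inverseImage g a ⊓ W := by
  rw [structureMap, omegaMap_comp, X.support_map]
  rfl

variable {g} {a b : S.Omega1 R} {V W : CompactOpens X.carrier} {Z : C}

theorem sieve_structureMap_of_le_single {T : C} {f : T ⟶ R} {hf : S.E f}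
    (hV : V ≤ inverseImage g (S.cls (EFamily.single f hf))) :
    sieve (S.cls (EFamily.single f hf)) (structureMap g V) := by
  obtain ⟨t, ht⟩ := X.factor le_top (pullback.fst g f)
    (S.E.of_isPullback (IsPullback.of_hasPullback _ _).flip hf) hV
  refine sieve_cls_single_iff.2 ⟨t ≫ pullback.snd g f, ?_⟩
  rw [Category.assoc, ← pullback.condition, ← Category.assoc, ht, structureMap]

theorem exists_cover_of_le_inverseImage (hW : W ≤ inverseImage g a) :
    ∃ (n : ℕ) (V : Fin n → CompactOpens X.carrier), Finset.univ.sup V = W ∧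
      ∀ i, ∃ (T : C) (f : T ⟶ R) (hf : S.E f), S.cls (EFamily.single f hf) ≤ a ∧
        V i ≤ inverseImage g (S.cls (EFamily.single f hf)) := by
  let c (i) : S.Omega1 R := S.cls (EFamily.single ((rep a).hom i) ((rep a).mem i))
  have hc : Finset.univ.sup c = a := (cls_eq_sup_single (rep a)).symm.trans (cls_rep a)
  have hgc : (Finset.univ.sup fun i => inverseImage g (c i)) = inverseImage g a :=
    (map_finset_sup (inverseImage g) _ c).symm.trans (congrArg _ hc)
  refine ⟨_, fun i => W ⊓ inverseImage g (c i), ?_, fun i => ⟨_, (rep a).hom i, (rep a).mem i,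
    (Finset.le_sup (f := c) (Finset.mem_univ i)).trans hc.le, inf_le_right⟩⟩
  rw [← Finset.sup_inf_distrib_left, hgc, inf_eq_left.2 hW]

theorem exists_cover_sieve_structureMap (hW : W ≤ inverseImage g a) :
    ∃ (n : ℕ) (V : Fin n → CompactOpens X.carrier), Finset.univ.sup V = W ∧
      ∀ i, sieve a (structureMap g (V i)) := by
  obtain ⟨n, V, hV, hVf⟩ := exists_cover_of_le_inverseImage hW
  refine ⟨n, V, hV, fun i => ?_⟩
  obtain ⟨T, f, hf, hfa, hVi⟩ := hVf i
  exact sieve_mono hfa _ (sieve_structureMap_of_le_single hVi)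

theorem hom_ext_of_le_inverseImage (hW : W ≤ inverseImage g a) {p q : X.sheaf.obj W ⟶ Z}
    (h : ∀ (V) (hV : V ≤ W), sieve a (structureMap g V) →
      X.sheaf.map (homOfLE hV) ≫ p = X.sheaf.map (homOfLE hV) ≫ q) : p = q := by
  obtain ⟨n, V, hV, H⟩ := exists_cover_sieve_structureMap hW
  have hVW (i) : V i ≤ W := hV ▸ Finset.le_sup (Finset.mem_univ i)
  exact X.isOpSheaf.hom_ext hV hVW fun i => h _ (hVW i) (H i)

theorem ext_of_le_inverseImage (hW : W ≤ inverseImage g a) {P Q : CompactOpens X.carrier}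
    (hP : P ≤ W) (hQ : Q ≤ W) (h : ∀ V ≤ W, sieve a (structureMap g V) → P ⊓ V = Q ⊓ V) :
    P = Q := by
  obtain ⟨n, V, hV, H⟩ := exists_cover_sieve_structureMap hW
  have hVW (i) : V i ≤ W := hV ▸ Finset.le_sup (Finset.mem_univ i)
  rw [← inf_eq_left.2 hP, ← inf_eq_left.2 hQ, ← hV, Finset.sup_inf_distrib_left,
    Finset.sup_inf_distrib_left]
  exact Finset.sup_congr rfl fun i _ => h _ (hVW i) (H i)

theorem exists_map_comp_eq_ι (hW : W ≤ inverseImage g a) :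
    ∃ m : X.sheaf.obj W ⟶ sections a, ∀ (V) (hV : V ≤ W) (H : sieve a (structureMap g V)),
      X.sheaf.map (homOfLE hV) ≫ m = sections.ι (structureMap g V) H := by
  obtain ⟨n, U, hU, hs⟩ := exists_cover_sieve_structureMap hW
  have hUW (i) : U i ≤ W := hU ▸ Finset.le_sup (Finset.mem_univ i)
  obtain ⟨m, hm, -⟩ := X.isOpSheaf.existsUnique_glue hU hUW (fun i => sections.ι _ (hs i))
    fun i j => sections.comp_ι_eq_comp_ι <| by rw [map_structureMap, map_structureMap]
  refine ⟨m, fun V hV H => ?_⟩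
  have hVU : (Finset.univ.sup fun i => V ⊓ U i) = V := by
    rw [← Finset.sup_inf_distrib_left, hU, inf_eq_left.2 hV]
  refine X.isOpSheaf.hom_ext hVU (fun i => inf_le_left) fun i => ?_
  calc X.sheaf.map (homOfLE inf_le_left) ≫ X.sheaf.map (homOfLE hV) ≫ m
      = X.sheaf.map (homOfLE inf_le_right) ≫ X.sheaf.map (homOfLE (hUW i)) ≫ m := by
        rw [sheaf_map_map_assoc, sheaf_map_map_assoc]
    _ = X.sheaf.map (homOfLE inf_le_right) ≫ sections.ι _ (hs i) := by rw [hm]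
    _ = X.sheaf.map (homOfLE inf_le_left) ≫ sections.ι _ H :=
        sections.comp_ι_eq_comp_ι <| by rw [map_structureMap, map_structureMap]

variable (g) in
/-- The morphism `𝒪(W) ⟶ sections a` induced by `Γ(X) ⟶ R` when `W` lies in the inverse image
of `a`. It is characterized by `map_toSections`. -/
def toSections (hW : W ≤ inverseImage g a) : X.sheaf.obj W ⟶ sections a :=
  (exists_map_comp_eq_ι hW).choose

theorem map_toSections (hW : W ≤ inverseImage g a) (hV : V ≤ W) (H : sieve a (structureMap g V)) :
    X.sheaf.map (homOfLE hV) ≫ toSections g hW = sections.ι (structureMap g V) H :=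
  (exists_map_comp_eq_ι hW).choose_spec V hV H

theorem eq_toSections (hW : W ≤ inverseImage g a) {m : X.sheaf.obj W ⟶ sections a}
    (h : ∀ (V) (hV : V ≤ W) (H : sieve a (structureMap g V)),
      X.sheaf.map (homOfLE hV) ≫ m = sections.ι (structureMap g V) H) : m = toSections g hW :=
  hom_ext_of_le_inverseImage hW fun V hV H => (h V hV H).trans (map_toSections hW hV H).symm

theorem map_comp_toSections (hV : V ≤ inverseImage g a) (hW : W ≤ inverseImage g b) (hab : a ≤ b)
    (hVW : V ≤ W) : X.sheaf.map (homOfLE hVW) ≫ toSections g hW =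
      toSections g hV ≫ sections.map hab :=
  hom_ext_of_le_inverseImage hV fun U hU H => by
    rw [sheaf_map_map_assoc, map_toSections _ _ (sieve_mono hab _ H), ← Category.assoc,
      map_toSections _ _ H, sections.ι_map]

theorem support_omegaMap_toSections (hW : W ≤ inverseImage g a) (b : S.Omega1 (sections a)) :
    (X.support W (S.omegaMap (toSections g hW) b) : CompactOpens X.carrier) =
      inverseImage g (supp a b) ⊓ W := by
  refine ext_of_le_inverseImage hW (X.support W _).2 inf_le_right fun V hV H => ?_
  rw [← X.support_map hV, ← omegaMap_comp, map_toSections hW hV H, ← omegaMap_supp,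
    support_structureMap, inf_assoc, inf_eq_right.2 hV]

end WeakScheme

namespace WeakScheme

open CoherentSite

variable {C : Type u} [Category.{v} C] [HasPullbacks C] [HasFiniteCoproducts C]
  {S : CoherentSite.{v, u} C} {X Y : WeakScheme.{w} S} {R A : C}

theorem inverseImage_comp (g : X.sheaf.obj ⊤ ⟶ A) (f : A ⟶ R) (a : S.Omega1 R) :
    inverseImage (g ≫ f) a = inverseImage g (S.omegaMap f a) :=
  congrArg (fun b => (X.support ⊤ b : CompactOpens X.carrier)) (omegaMap_comp _ _ _ _)

theorem structureMap_comp (g : X.sheaf.obj ⊤ ⟶ A) (f : A ⟶ R) (W : CompactOpens X.carrier) :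
    structureMap (g ≫ f) W = structureMap g W ≫ f :=
  (Category.assoc _ _ _).symm

/-- The composite `Γ(X) ⟶ Γ(Y) ⟶ R`. -/
def precomp (φ : X ⟶ Y) (g : Y.sheaf.obj ⊤ ⟶ R) : X.sheaf.obj ⊤ ⟶ R :=
  X.sheaf.map (homOfLE (show ⊤ ≤ φ.base.comap ⊤ from fun _ h => h)) ≫ φ.app ⊤ ≫ g

theorem Γ_map_comp (φ : X ⟶ Y) (g : (Γ S).obj Y ⟶ R) : (Γ S).map φ ≫ g = precomp φ g :=
  Category.assoc _ _ _

theorem inverseImage_precomp (φ : X ⟶ Y) (g : Y.sheaf.obj ⊤ ⟶ R) (a : S.Omega1 R) :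
    inverseImage (precomp φ g) a = φ.base.comap (inverseImage g a) := by
  have htop : ⊤ ≤ φ.base.comap ⊤ := fun _ h => h
  calc inverseImage (precomp φ g) a
      = (X.support (φ.base.comap ⊤) (S.omegaMap (φ.app ⊤) (S.omegaMap g a)) :
          CompactOpens X.carrier) ⊓ ⊤ := by
        rw [← X.support_map htop, ← omegaMap_comp, ← omegaMap_comp, Category.assoc]
        rfl
    _ = φ.base.comap (inverseImage g a) := by
        rw [inf_top_eq, φ.support_app]
        rfl

theorem app_comp_structureMap (φ : X ⟶ Y) (g : Y.sheaf.obj ⊤ ⟶ R) (U : CompactOpens Y.carrier) :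
    φ.app U ≫ structureMap g U = structureMap (precomp φ g) (φ.base.comap U) := by
  rw [structureMap, ← Category.assoc, ← φ.naturality, Category.assoc, structureMap, precomp,
    sheaf_map_map_assoc]

end WeakScheme

/-! ### The universal property of the spectrum -/

namespace CoherentSite.spec

open WeakScheme

variable {C : Type u} [Category.{v} C] [HasPullbacks C] [HasFiniteCoproducts C]
  {S : CoherentSite.{v, u} C} {R : C} [Small.{w} (S.Omega1 R)]

theorem inverseImage_toBase (a : S.Omega1 R) :
    inverseImage (toBase.{w} (S := S) (R := R) ⊤) a = basicOpen S R a :=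
  (support_omegaMap_toBase ⊤ a).trans (inf_top_eq _)

theorem structureMap_toBase (U : CompactOpens (spec.{w} S R).carrier) :
    structureMap (toBase ⊤) U = toBase U :=
  map_toBase le_top

variable {X : WeakScheme.{w} S}

section Lift

variable (g : X.sheaf.obj ⊤ ⟶ R)

theorem comap_spectralMapTo (U : CompactOpens (spec.{w} S R).carrier) :
    (IdealSpectrum.spectralMapTo (inverseImage g)).comap U =
      inverseImage g ((basicOpen S R).symm U) :=
  (congrArg _ ((basicOpen S R).apply_symm_apply U).symm).trans
    (IdealSpectrum.comap_spectralMapTo_basic _ _)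

/-- The morphism `X ⟶ Spec R` corresponding to `g : Γ(X) ⟶ R`. -/
def lift : X ⟶ spec.{w} S R where
  base := IdealSpectrum.spectralMapTo (inverseImage g)
  app U := toSections g (comap_spectralMapTo g U).le
  naturality {V U} h := map_comp_toSections (comap_spectralMapTo g V).le
    (comap_spectralMapTo g U).le ((basicOpen S R).symm.monotone h) _
  support_app U b := by
    refine (support_omegaMap_toSections (comap_spectralMapTo g U).le b).trans
      (Eq.trans (inf_eq_left.2 ?_) (IdealSpectrum.comap_spectralMapTo_basic _ _).symm)
    exact (OrderHomClass.mono (inverseImage g) (supp_le _ b)).trans (comap_spectralMapTo g U).ge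

theorem comap_base_lift_basicOpen (a : S.Omega1 R) :
    (lift.{w} g).base.comap (basicOpen S R a) = inverseImage g a :=
  IdealSpectrum.comap_spectralMapTo_basic _ _

theorem precomp_lift_toBase : precomp (lift.{w} g) (toBase ⊤) = g := by
  have H : sieve ((basicOpen.{w} S R).symm ⊤) (structureMap g ⊤) := by
    rw [map_top, sieve_top]
    trivial
  have h : X.sheaf.map (homOfLE le_top) ≫ (lift.{w} g).app ⊤ = ι (structureMap g ⊤) H :=
    map_toSections (comap_spectralMapTo g ⊤).le _ H
  refine (Category.assoc _ _ _).symm.trans ((congrArg (· ≫ _) h).trans ?_)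
  rw [ι_toBase, structureMap_top]

end Lift

section Uniqueness

variable (φ : X ⟶ spec.{w} S R)

theorem comap_base (U : CompactOpens (spec.{w} S R).carrier) :
    φ.base.comap U = inverseImage (precomp φ (toBase ⊤)) ((basicOpen S R).symm U) := by
  rw [inverseImage_precomp, inverseImage_toBase, OrderIso.apply_symm_apply]

theorem app_comp_toBase (U : CompactOpens (spec.{w} S R).carrier) :
    φ.app U ≫ toBase U = structureMap (precomp φ (toBase ⊤)) (φ.base.comap U) := by
  rw [← structureMap_toBase, app_comp_structureMap]

variable {φ}

theorem map_comp_app_basicOpen_single {T : C} {f : T ⟶ R} {hf : S.E f}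
    {V : CompactOpens X.carrier}
    (hV : V ≤ φ.base.comap (basicOpen S R (S.cls (EFamily.single f hf))))
    (H : sieve _ (structureMap (precomp φ (toBase ⊤)) V)) :
    X.sheaf.map (homOfLE hV) ≫ φ.app (basicOpen S R (S.cls (EFamily.single f hf))) =
      ι (structureMap (precomp φ (toBase ⊤)) V) H := by
  have := mono_toBase_basicOpen_single.{w} f hf
  rw [← cancel_mono (toBase _), Category.assoc, app_comp_toBase, map_structureMap, ι_toBase]

theorem app_eq_toSections {g : X.sheaf.obj ⊤ ⟶ R} (hg : precomp φ (toBase ⊤) = g)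
    {U : CompactOpens (spec.{w} S R).carrier}
    (hU : φ.base.comap U ≤ inverseImage g ((basicOpen S R).symm U)) :
    φ.app U = toSections g hU := by
  subst hg
  obtain ⟨n, V, hV, hVf⟩ := exists_cover_of_le_inverseImage hU
  have hVU (i) : V i ≤ φ.base.comap U := hV ▸ Finset.le_sup (Finset.mem_univ i)
  refine X.isOpSheaf.hom_ext hV hVU fun i => ?_
  obtain ⟨T, f, hf, hfU, hVi⟩ := hVf i
  let B := basicOpen.{w} S R (S.cls (EFamily.single f hf))
  have hBU : B ≤ U := (OrderIso.le_symm_apply _).1 hfU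
  have hB : (basicOpen S R).symm B = S.cls (EFamily.single f hf) := OrderIso.symm_apply_apply _ _
  have hViB : V i ≤ φ.base.comap B := hVi.trans <| by rw [comap_base, hB]
  have H : sieve ((basicOpen S R).symm B) (structureMap (precomp φ (toBase ⊤)) (V i)) := by
    rw [hB]
    exact sieve_structureMap_of_le_single hVi
  refine Eq.trans ?_ (map_toSections hU _ (sieve_mono hfU _ (hB ▸ H))).symm
  calc X.sheaf.map (homOfLE (hVU i)) ≫ φ.app U
      = X.sheaf.map (homOfLE hViB) ≫ φ.app B ≫ (spec S R).sheaf.map (homOfLE hBU) := by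
        rw [← φ.naturality hBU, sheaf_map_map_assoc]
    _ = ι _ (sieve_mono ((basicOpen S R).symm.monotone hBU) _ H) := by
        rw [← Category.assoc, map_comp_app_basicOpen_single hViB H, ι_map]

theorem hom_ext_of_precomp_toBase_eq {ψ : X ⟶ spec.{w} S R}
    (h : precomp φ (toBase ⊤) = precomp ψ (toBase ⊤)) : φ = ψ := by
  have hbase : φ.base = ψ.base :=
    spectralMap_ext_of_comap_eq fun U => by rw [comap_base, comap_base, h]
  have happ (U) : φ.app U = toSections _ (comap_base φ U).le := app_eq_toSections rfl _
  have happ' (U) : ψ.app U = toSections (precomp φ (toBase ⊤)) (h ▸ (comap_base ψ U).le) :=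
    app_eq_toSections h.symm _
  obtain ⟨base, app, _, _⟩ := φ
  obtain ⟨_, app', _, _⟩ := ψ
  subst hbase
  exact Hom.ext rfl (heq_of_eq (funext fun U => (happ U).trans (happ' U).symm))

end Uniqueness

/-- The bijection between morphisms `Γ(X) ⟶ R` and morphisms `X ⟶ Spec R`. -/
def homEquiv (X : WeakScheme.{w} S) (R : C) [Small.{w} (S.Omega1 R)] :
    ((Γ S).obj X ⟶ R) ≃ (X ⟶ spec.{w} S R) where
  toFun g := lift g
  invFun φ := (Γ S).map φ ≫ toBase ⊤
  left_inv g := (Γ_map_comp _ _).trans (precomp_lift_toBase g)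
  right_inv _ := hom_ext_of_precomp_toBase_eq <|
    (precomp_lift_toBase _).trans (Γ_map_comp _ _)

end CoherentSite.spec

/-! ### The functor `Spec` -/

namespace CoherentSite.spec

open WeakScheme

variable {C : Type u} [Category.{v} C] [HasPullbacks C] [HasFiniteCoproducts C]
  {S : CoherentSite.{v, u} C}

section BaseChange

variable {A B : C} [Small.{w} (S.Omega1 A)] {f : A ⟶ B} {b : S.Omega1 B}
  {U : CompactOpens (spec.{w} S A).carrier}

theorem inverseImage_toBase_comp (f : A ⟶ B) (b : S.Omega1 B) :
    inverseImage (toBase.{w} (S := S) ⊤ ≫ f) b = basicOpen S A (S.omegaMap f b) :=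
  (inverseImage_comp _ _ _).trans (inverseImage_toBase _)

theorem ι_comp_structureMap_toBase_comp {T : C} {h : T ⟶ A}
    (H : sieve ((basicOpen S A).symm U) h) (f : A ⟶ B) :
    ι h H ≫ structureMap (toBase ⊤ ≫ f) U = h ≫ f := by
  rw [structureMap_comp, structureMap_toBase, ← Category.assoc, ι_toBase]

theorem toSections_toBase_comp (hU : U ≤ inverseImage (toBase ⊤ ≫ f) b)
    (hb : (basicOpen S A).symm U ≤ S.omegaMap f b) :
    toSections (toBase ⊤ ≫ f) hU = sections.baseChange f hb := by
  refine (eq_toSections hU fun V hV H => sections.hom_ext fun h Hh => ?_).symm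
  calc ι h Hh ≫ (spec S A).sheaf.map (homOfLE hV) ≫ sections.baseChange f hb
      = sections.ι (h ≫ f) _ :=
        (Category.assoc _ _ _).symm.trans <|
          (congrArg (· ≫ _) (ι_map hV Hh)).trans (sections.ι_baseChange f hb _)
    _ = ι h Hh ≫ sections.ι (structureMap (toBase ⊤ ≫ f) V) H :=
        (sections.comp_ι_eq_ι (ι_comp_structureMap_toBase_comp Hh f)).symm

theorem ι_comp_lift_app [Small.{w} (S.Omega1 B)] {T : C} {h : T ⟶ A}
    {V : CompactOpens (spec.{w} S B).carrier}
    (H : sieve ((basicOpen S A).symm ((lift (toBase ⊤ ≫ f)).base.comap V)) h)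
    (H' : sieve ((basicOpen S B).symm V) (h ≫ f)) :
    ι h H ≫ (lift (toBase ⊤ ≫ f)).app V = ι (h ≫ f) H' := by
  have hV := (comap_spectralMapTo (toBase.{w} (S := S) ⊤ ≫ f) V).le
  have hb := (OrderIso.symm_apply_le _).2 (hV.trans (inverseImage_toBase_comp f _).le)
  exact (congrArg (ι h H ≫ ·) (toSections_toBase_comp hV hb)).trans
    (sections.ι_baseChange f hb H)

end BaseChange

section Functor

variable (S) [∀ R : C, Small.{w} (S.Omega1 R)]

theorem homEquiv_naturality (X' X : WeakScheme.{w} S) (R : C) (f : X' ⟶ X)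
    (g : (Γ S).obj X ⟶ R) :
    homEquiv X' R ((Γ S).map f ≫ g) = f ≫ homEquiv X R g := by
  apply (homEquiv X' R).symm.injective
  rw [Equiv.symm_apply_apply]
  calc (Γ S).map f ≫ g
      = (Γ S).map f ≫ (homEquiv X R).symm (homEquiv X R g) := by rw [Equiv.symm_apply_apply]
    _ = (homEquiv X' R).symm (f ≫ homEquiv X R g) :=
        (Category.assoc _ _ _).symm.trans (congrArg (· ≫ _) ((Γ S).map_comp _ _).symm)

/-- The functor `Spec`. -/
def functor : C ⥤ WeakScheme.{w} S :=
  Adjunction.rightAdjointOfEquiv (fun X R => homEquiv X R) (homEquiv_naturality S)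

/-- The adjunction between global sections and `Spec`. -/
def adjunction : Γ.{w} S ⊣ functor.{w} S :=
  Adjunction.adjunctionOfEquivRight (fun X R => homEquiv X R) (homEquiv_naturality S)

theorem adjunction_counit_app (R : C) : (adjunction.{w} S).counit.app R = toBase ⊤ :=
  (Adjunction.adjunctionOfEquivRight_counit_app _ _ R).trans <|
    (congrArg (· ≫ _) ((Γ S).map_id _)).trans (Category.id_comp _)

theorem functor_map {A B : C} (f : A ⟶ B) : (functor.{w} S).map f = lift (toBase ⊤ ≫ f) := by
  refine congrArg (fun p => lift (p ≫ f)) ?_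
  exact (congrArg (· ≫ _) ((Γ S).map_id _)).trans (Category.id_comp _)

theorem isInducedBy_functor_map {A B : C} (f : A ⟶ B) :
    (spectrumData S A).IsInducedBy (spectrumData S B) f ((functor.{w} S).map f) := by
  rw [functor_map]
  intro F
  have hcomap : (lift (toBase ⊤ ≫ f)).base.comap (basicOpen.{w} S B (S.cls F)) =
      basicOpen S A (S.cls (F.pullback f)) :=
    (comap_base_lift_basicOpen _ _).trans (inverseImage_toBase_comp f _)
  refine ⟨hcomap, fun i => ?_⟩
  have hfst : sieve ((basicOpen.{w} S B).symm (basicOpen S B (S.cls F)))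
      (pullback.fst f (F.hom i) ≫ f) := by
    rw [pullback.condition]
    exact Sieve.downward_closed _ (sieve_symm_basicOpen_hom F i) _
  calc Sigma.ι (F.pullback f).obj i ≫ π (F.pullback f) ≫
          (spec S A).sheaf.map (homOfLE hcomap.ge) ≫ (lift (toBase ⊤ ≫ f)).app _
      = ι (pullback.fst f (F.hom i)) _ ≫ (lift (toBase ⊤ ≫ f)).app _ := by
        rw [← Category.assoc, ι_π, ← Category.assoc, ι_map]
    _ = ι (pullback.fst f (F.hom i) ≫ f) hfst := ι_comp_lift_app _ hfst
    _ = pullback.snd f (F.hom i) ≫ Sigma.ι F.obj i ≫ π F := by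
        rw [ι_π]
        exact (sections.comp_ι_eq_ι pullback.condition.symm).symm

end Functor

end CoherentSite.spec

end

theorem mainTheorem4 {C : Type u} [Category.{v} C] [HasPullbacks C] [HasFiniteCoproducts C]
    (S : CoherentSite.{v, u} C) [∀ R : C, Small.{w} (S.Omega1 R)] :
    ∃ (Spec : C ⥤ WeakScheme.{w} S) (adj : WeakScheme.Γ.{w} S ⊣ Spec)
      (D : ∀ R : C, SpectrumData S R (Spec.obj R)),
      (∀ {A B : C} (f : A ⟶ B), (D A).IsInducedBy (D B) f (Spec.map f)) ∧
      (∀ R : C, IsIso (D R).canonical ∧ (D R).canonical ≫ adj.counit.app R = 𝟙 R) ∧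
      Spec.Full ∧ Spec.Faithful := by
  let adj := CoherentSite.spec.adjunction.{w} S
  let D (R : C) := CoherentSite.spec.spectrumData.{w} S R
  have canonical_counit (R : C) : (D R).canonical ≫ adj.counit.app R = 𝟙 R := by
    rw [CoherentSite.spec.adjunction_counit_app]
    exact CoherentSite.spec.canonical_comp_toBase
  have counit_canonical (R : C) : adj.counit.app R ≫ (D R).canonical = 𝟙 _ := by
    rw [CoherentSite.spec.adjunction_counit_app]
    exact CoherentSite.spec.toBase_comp_canonical
  have (R : C) : IsIso (adj.counit.app R) := ⟨_, counit_canonical R, canonical_counit R⟩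
  have := NatIso.isIso_of_isIso_app adj.counit
  exact ⟨CoherentSite.spec.functor S, adj, D, CoherentSite.spec.isInducedBy_functor_map S,
    fun R => ⟨⟨_, canonical_counit R, counit_canonical R⟩, canonical_counit R⟩,
    adj.fullyFaithfulROfIsIsoCounit.full, adj.fullyFaithfulROfIsIsoCounit.faithful⟩
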